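/- Let $\alpha\ge 0$ and $1<p<\infty$. Let $\mathbb{D}$ be the open unit disc, $\mathbb{T}$ the unit circle with Lebesgue measure $d\theta$, and $\mu_\alpha(z)=|z-1|^{2\alpha}$. For a weight $\omega$ on $\mathbb{T}$ write $L^p(\mathbb{T},\omega)$ for the space $L^p(\mathbb{T},\omega\,d\theta)$. Let $\mathcal{H}^2(\mathbb{T},\mu_\alpha)$ be the weighted Hardy space of holomorphic functions $f$ on $\mathbb{D}$ with $$\sup_{0\le r<1}\int_0^{2\pi}|f(re^{i\theta})|^2\,|re^{i\theta}-1|^{2\alpha}\,d\theta<\infty,$$ regarded as a closed subspace of $L^2(\mathbb{T},\mu_\alpha)$ through almost everywhere radial boundary values, and let the weighted Szegő projection $\mathbf{S}_{\mu_\alpha}$ be the orthogonal projection of $L^2(\mathbb{T},\mu_\alpha)$ onto $\mathcal{H}^2(\mathbb{T},\mu_\alpha)$. Then $\mathbf{S}_{\mu_\alpha}$ is bounded on $L^p(\mathbb{T},|z-1|^{\alpha p})$: there is a unique bounded linear operator on $L^p(\mathbb{T},|z-1|^{\alpha p})$ that agrees with $\mathbf{S}_{\mu_\alpha}$ on $L^2(\mathbb{T},\mu_\alpha)\cap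 L^p(\mathbb{T},|z-1|^{\alpha p})$. -/

import Mathlib

open MeasureTheory Filter Topology
open scoped ENNReal

noncomputable section

/-- The unit circle, parametrised by the angle `θ` modulo `2π`; its `volume` is Lebesgue measure
`dθ`, of total mass `2π`. -/
abbrev Torus : Type := AddCircle (2 * Real.pi)

instance fact_two_pi_pos : Fact (0 < 2 * Real.pi) := ⟨Real.two_pi_pos⟩

/-- The point `e^{iθ}` of the complex plane. -/
def expI (θ : Torus) : ℂ := (AddCircle.toCircle θ : ℂ)

/-- The weight `|z - 1| ^ β`, as a function on the complex plane. -/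
def weight (β : ℝ) (z : ℂ) : ℝ≥0∞ := ENNReal.ofReal (‖z - 1‖ ^ β)

/-- The measure `|e^{iθ} - 1| ^ β dθ` on the circle, so that `Lp ℂ p (circleMeasure β)` is the
weighted space `L^p(𝕋, |z - 1| ^ β)`. -/
def circleMeasure (β : ℝ) : Measure Torus :=
  (volume : Measure Torus).withDensity fun θ => weight β (expI θ)

/-- The function `f` is holomorphic on the open unit disc and its weighted square integrals
`∫ |f(r e^{iθ})|² |r e^{iθ} - 1| ^ β dθ` are bounded uniformly in `0 ≤ r < 1`. -/
def MemHardyTwo (β : ℝ) (f : ℂ → ℂ) : Prop :=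
  DifferentiableOn ℂ f (Metric.ball 0 1) ∧
    (⨆ r ∈ Set.Ico (0 : ℝ) 1, ∫⁻ θ : Torus, ‖f (r * expI θ)‖ₑ ^ 2 * weight β (r * expI θ)) < ∞

/-- `F` is the radial boundary function of `f`, almost everywhere on the circle. -/
def HasRadialLimit (f : ℂ → ℂ) (F : Torus → ℂ) : Prop :=
  ∀ᵐ θ : Torus, Tendsto (fun r : ℝ => f (r * expI θ)) (𝓝[<] 1) (𝓝 (F θ))

theorem continuous_expI : Continuous expI :=
  continuous_subtype_val.comp AddCircle.continuous_toCircle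

theorem norm_expI (θ : Torus) : ‖expI θ‖ = 1 := Circle.norm_coe _

theorem measurable_weight (β : ℝ) : Measurable (weight β) := by
  unfold weight
  fun_prop

theorem measurable_of_memHardyTwo {β : ℝ} {f : ℂ → ℂ} (hf : MemHardyTwo β f) {r : ℝ}
    (hr : r ∈ Set.Ico (0 : ℝ) 1) :
    Measurable fun θ : Torus => ‖f (r * expI θ)‖ₑ ^ 2 * weight β (r * expI θ) := by
  have hc : Continuous fun θ : Torus => (r : ℂ) * expI θ := continuous_const.mul continuous_expI
  have h : Continuous fun θ : Torus => f (r * expI θ) := by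
    refine hf.1.continuousOn.comp_continuous hc fun θ => ?_
    simp [norm_expI, abs_of_nonneg hr.1, hr.2]
  exact (h.measurable.enorm.pow_const 2).mul ((measurable_weight β).comp hc.measurable)

theorem MemHardyTwo.zero (β : ℝ) : MemHardyTwo β 0 :=
  ⟨differentiableOn_const 0, by simp⟩

theorem MemHardyTwo.add {β : ℝ} {f g : ℂ → ℂ} (hf : MemHardyTwo β f) (hg : MemHardyTwo β g) :
    MemHardyTwo β (f + g) := by
  refine ⟨hf.1.add hg.1, lt_of_le_of_lt ?_ (ENNReal.mul_lt_top (a := 2) (by simp)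
    (ENNReal.add_lt_top.2 ⟨hf.2, hg.2⟩))⟩
  refine iSup₂_le fun r hr => ?_
  calc ∫⁻ θ : Torus, ‖(f + g) (r * expI θ)‖ₑ ^ 2 * weight β (r * expI θ)
      ≤ ∫⁻ θ : Torus, 2 * (‖f (r * expI θ)‖ₑ ^ 2 * weight β (r * expI θ)
          + ‖g (r * expI θ)‖ₑ ^ 2 * weight β (r * expI θ)) := by
        refine lintegral_mono fun θ => ?_
        rw [← add_mul, ← mul_assoc]
        refine mul_le_mul_left ?_ _
        refine (pow_le_pow_left' (enorm_add_le _ _) 2).trans ?_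
        have := ENNReal.rpow_add_le_mul_rpow_add_rpow ‖f (r * expI θ)‖ₑ ‖g (r * expI θ)‖ₑ
          (p := 2) (by norm_num)
        norm_num at this
        exact_mod_cast this
    _ = 2 * (∫⁻ θ : Torus, ‖f (r * expI θ)‖ₑ ^ 2 * weight β (r * expI θ))
          + 2 * ∫⁻ θ : Torus, ‖g (r * expI θ)‖ₑ ^ 2 * weight β (r * expI θ) := by
        rw [lintegral_const_mul' _ _ (by simp), lintegral_add_left (measurable_of_memHardyTwo hf hr), mul_add]
    _ ≤ _ := by
        rw [mul_add]
        gcongr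
        · exact le_iSup₂_of_le r hr le_rfl
        · exact le_iSup₂_of_le r hr le_rfl

theorem MemHardyTwo.smul {β : ℝ} {f : ℂ → ℂ} (c : ℂ) (hf : MemHardyTwo β f) :
    MemHardyTwo β (c • f) := by
  refine ⟨hf.1.const_smul c, lt_of_le_of_lt ?_ (ENNReal.mul_lt_top (a := ‖c‖ₑ ^ 2)
    (by simp) hf.2)⟩
  refine iSup₂_le fun r hr => ?_
  calc ∫⁻ θ : Torus, ‖(c • f) (r * expI θ)‖ₑ ^ 2 * weight β (r * expI θ)
      = ∫⁻ θ : Torus, ‖c‖ₑ ^ 2 * (‖f (r * expI θ)‖ₑ ^ 2 * weight β (r * expI θ)) := by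
        simp [mul_pow, mul_assoc]
    _ = ‖c‖ₑ ^ 2 * ∫⁻ θ : Torus, ‖f (r * expI θ)‖ₑ ^ 2 * weight β (r * expI θ) :=
        lintegral_const_mul _ (measurable_of_memHardyTwo hf hr)
    _ ≤ _ := by
        gcongr
        exact le_iSup₂_of_le r hr le_rfl

/-- The only zero of the weight on the circle is one point, so the weighted measure and Lebesgue
measure have the same null sets. -/
theorem volume_ac_circleMeasure (β : ℝ) : (volume : Measure Torus) ≪ circleMeasure β := by
  refine withDensity_absolutelyContinuous' 
    ((measurable_weight β).comp continuous_expI.measurable).aemeasurable ?_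
  have h : ∀ᵐ θ : Torus, θ ≠ 0 := by
    have h0 := AddCircle.volume_closedBall (2 * Real.pi) (x := 0) 0
    simpa [ae_iff, Real.two_pi_pos.le] using h0
  filter_upwards [h] with θ hθ
  have : expI θ - 1 ≠ 0 := fun h0 => hθ <|
    AddCircle.injective_toCircle Real.two_pi_pos.ne' <| Circle.ext <| by
      simpa [expI] using sub_eq_zero.1 h0
  simpa [weight] using Real.rpow_pos_of_pos (norm_pos_iff.2 this) β

/-- The weighted Hardy space `H²(𝕋, |z - 1| ^ β)`, as a subspace of `L²(𝕋, |z - 1| ^ β)` through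
radial boundary functions. -/
def hardyTwo (β : ℝ) : Submodule ℂ (Lp ℂ 2 (circleMeasure β)) where
  carrier := {F | ∃ f : ℂ → ℂ, MemHardyTwo β f ∧ HasRadialLimit f F}
  zero_mem' := ⟨0, MemHardyTwo.zero β, by
    filter_upwards [(volume_ac_circleMeasure β).ae_le (Lp.coeFn_zero ℂ 2 (circleMeasure β))]
      with θ hθ
    rw [hθ]
    exact tendsto_const_nhds⟩
  add_mem' := by
    rintro F G ⟨f, hf, hF⟩ ⟨g, hg, hG⟩
    refine ⟨f + g, hf.add hg, ?_⟩
    filter_upwards [hF, hG, (volume_ac_circleMeasure β).ae_le (Lp.coeFn_add F G)] with θ h1 h2 h3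
    rw [h3]
    exact h1.add h2
  smul_mem' := by
    rintro c F ⟨f, hf, hF⟩
    refine ⟨c • f, hf.smul c, ?_⟩
    filter_upwards [hF, (volume_ac_circleMeasure β).ae_le (Lp.coeFn_smul c F)] with θ h1 h2
    rw [h2]
    exact h1.const_smul c

/-- The weighted Szegő projection for the weight `|z - 1| ^ β`: the orthogonal projection of
`L²(𝕋, |z - 1| ^ β)` onto the Hardy space `H²(𝕋, |z - 1| ^ β)`. (The Hardy space is a closed
subspace for the weights `β ≥ 0`; taking its closure only makes the projection available
without a proof of this.) -/
def szegoProjection (β : ℝ) : Lp ℂ 2 (circleMeasure β) →L[ℂ] Lp ℂ 2 (circleMeasure β) :=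
  (hardyTwo β).topologicalClosure.starProjection

end

/-! On the circle the weight is the modulus of an outer function: with h = (1 - z)^α one has |h| =
|z - 1|^α. Multiplication by h is, up to the constant coming from normalising dθ, an isometry of
L²(|z - 1|^{2α}) onto L², and it carries the closure of the weighted Hardy space onto the ordinary
one. Indeed h f has bounded quadratic means whenever f belongs to the weighted space, and conversely
every z^n / h belongs to the weighted space (`topologicalClosure_hardyTwo`). Hence the Szegő
projection is h⁻¹ P h with P the Riesz projection (`exists_outer_mul_szegoProjection_eq`). The same
multiplication is, up to a constant, an isometry of L^p(|z - 1|^{αp}) into L^p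
(`eLpNorm_circleMeasure`), so the weighted bound is exactly the theorem of M. Riesz for P.

That theorem is proved by complex methods. For 1 < p ≤ 2 and u ≥ 0 not almost everywhere zero, the
Cauchy integral g of u has positive real part, so g^p is holomorphic. An inequality |w|^p ≤ A (Re
w)^p - B Re(w^p) on the right half-plane, combined with the mean value property of g^p, bounds the
L^p means of g by those of Re g. The boundary value of Re g is (u + mean of u)/2, which is
controlled by u. Splitting into four nonnegative pieces treats general u, and self-adjointness of P
gives p > 2 by duality.

Finally, the functions lying in both spaces are dense in L^p(|z - 1|^{αp}), which yields both the
extension and its uniqueness. -/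

noncomputable section

/-! ### Fourier coefficients and the Riesz projection on L². -/

/-- Normalised Lebesgue measure on the circle. -/
abbrev haarTorus : Measure Torus := AddCircle.haarAddCircle

/-- The space `L²` of the circle, with normalised Lebesgue measure. -/
abbrev CircleL2 : Type := Lp ℂ 2 haarTorus

/-- The Fourier basis of `L²` of the circle. -/
abbrev circleBasis : HilbertBasis ℤ ℂ CircleL2 := fourierBasis

theorem fourier_natCast_eq_expI_pow (n : ℕ) (θ : Torus) : fourier (n : ℤ) θ = expI θ ^ n := by
  simp [fourier_apply, expI, AddCircle.toCircle_nsmul]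

/-- The Hardy space of the circle: the closed span of the characters of nonnegative frequency. -/
def hardyCircle : Submodule ℂ CircleL2 :=
  (Submodule.span ℂ (Set.range fun n : ℕ => circleBasis (n : ℤ))).topologicalClosure

theorem isClosed_hardyCircle : IsClosed (hardyCircle : Set CircleL2) :=
  Submodule.isClosed_topologicalClosure _

instance completeSpace_hardyCircle : CompleteSpace hardyCircle :=
  isClosed_hardyCircle.completeSpace_coe

/-- The Riesz projection: the orthogonal projection of `L²` onto the Hardy space. -/
def rieszProjection : CircleL2 →L[ℂ] CircleL2 := hardyCircle.starProjection

theorem circleBasis_mem_hardyCircle (n : ℕ) : circleBasis (n : ℤ) ∈ hardyCircle :=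
  Submodule.le_topologicalClosure _ (Submodule.subset_span ⟨n, rfl⟩)

theorem rieszProjection_mem (u : CircleL2) : rieszProjection u ∈ hardyCircle :=
  Submodule.starProjection_apply_mem _ _

theorem rieszProjection_circleBasis_of_neg {n : ℤ} (hn : n < 0) :
    rieszProjection (circleBasis n) = 0 := by
  rw [rieszProjection, Submodule.starProjection_apply_eq_zero_iff, hardyCircle,
    Submodule.orthogonal_closure, Submodule.mem_orthogonal]
  intro u hu
  induction hu using Submodule.span_induction with
  | mem x hx =>
    obtain ⟨m, rfl⟩ := hx
    exact circleBasis.orthonormal.2 (by omega)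
  | zero => simp
  | add x y _ _ hx hy => rw [inner_add_left, hx, hy, add_zero]
  | smul c x _ hx => rw [inner_smul_left, hx, mul_zero]

/-- Self-adjointness moves the projection onto the basis vector, which is either fixed or killed. -/
theorem repr_rieszProjection (u : CircleL2) (n : ℤ) :
    circleBasis.repr (rieszProjection u) n = if 0 ≤ n then circleBasis.repr u n else 0 := by
  have key : circleBasis.repr (rieszProjection u) n =
      inner ℂ (rieszProjection (circleBasis n)) u := by
    rw [HilbertBasis.repr_apply_apply, rieszProjection,
      Submodule.inner_starProjection_left_eq_right]
  split_ifs with hn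
  · lift n to ℕ using hn
    rw [key, rieszProjection,
      Submodule.starProjection_eq_self_iff.2 (circleBasis_mem_hardyCircle n),
      HilbertBasis.repr_apply_apply]
  · rw [key, rieszProjection_circleBasis_of_neg (not_le.1 hn), inner_zero_left]

theorem circleL2_ext {u v : CircleL2} (h : ∀ n, circleBasis.repr u n = circleBasis.repr v n) :
    u = v :=
  circleBasis.repr.injective (lp.ext (funext h))

theorem mem_hardyCircle_iff {u : CircleL2} :
    u ∈ hardyCircle ↔ ∀ n < 0, circleBasis.repr u n = 0 := by
  constructor
  · intro hu n hn
    have := repr_rieszProjection u n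
    rwa [if_neg (not_le.2 hn), rieszProjection,
      Submodule.starProjection_eq_self_iff.2 hu] at this
  · intro hu
    have : rieszProjection u = u := circleL2_ext fun n => by
      rw [repr_rieszProjection]
      split_ifs with hn
      · rfl
      · exact (hu n (not_le.1 hn)).symm
    exact this ▸ rieszProjection_mem u

theorem norm_sq_eq_tsum_repr (u : CircleL2) :
    HasSum (fun n => ‖circleBasis.repr u n‖ ^ 2) (‖u‖ ^ 2) := by
  have := lp.hasSum_norm (p := 2) (by simp) (circleBasis.repr u)
  simpa using this

/-! ### Power series, dilates and radial boundary functions. -/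

/-- Abel means converge in `L²`. -/
theorem tendsto_of_repr_eq_pow_mul {v : ℝ → CircleL2} {u : CircleL2}
    (h : ∀ r ∈ Set.Ico (0 : ℝ) 1, ∀ n : ℤ,
      circleBasis.repr (v r) n = (r : ℂ) ^ n.natAbs * circleBasis.repr u n) :
    Tendsto v (𝓝[<] 1) (𝓝 u) := by
  have hev : ∀ᶠ r : ℝ in 𝓝[<] 1, r ∈ Set.Ico (0 : ℝ) 1 := Ico_mem_nhdsLT one_pos
  have hsum := norm_sq_eq_tsum_repr u
  have key : Tendsto (fun r : ℝ => ∑' n : ℤ, ((1 - r ^ n.natAbs) * ‖circleBasis.repr u n‖) ^ 2)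
      (𝓝[<] 1) (𝓝 (∑' _ : ℤ, (0 : ℝ))) := by
    -- The squared moduli of the coefficients of `u` dominate, since 0 ≤ 1 - r^|n| ≤ 1.
    refine tendsto_tsum_of_dominated_convergence hsum.summable (fun n => ?_) ?_
    · refine Tendsto.mono_left ?_ nhdsWithin_le_nhds
      have : Continuous fun r : ℝ => ((1 - r ^ n.natAbs) * ‖circleBasis.repr u n‖) ^ 2 := by
        fun_prop
      simpa using this.tendsto 1
    · filter_upwards [hev] with r hr n
      have h1 : r ^ n.natAbs ≤ 1 := pow_le_one₀ hr.1 hr.2.le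
      have h0 : 0 ≤ r ^ n.natAbs := pow_nonneg hr.1 _
      rw [Real.norm_of_nonneg (sq_nonneg _), mul_pow]
      refine mul_le_of_le_one_left (sq_nonneg _) (pow_le_one₀ (by linarith) (by linarith))
  rw [tsum_zero] at key
  rw [tendsto_iff_norm_sub_tendsto_zero]
  have hsq : Tendsto (fun r => ‖v r - u‖ ^ 2) (𝓝[<] 1) (𝓝 0) := by
    refine key.congr' ?_
    filter_upwards [hev] with r hr
    refine (HasSum.tsum_eq ?_)
    convert norm_sq_eq_tsum_repr (v r - u) using 2 with n
    rw [map_sub, lp.coeFn_sub, Pi.sub_apply, h r hr n]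
    have h1 : r ^ n.natAbs ≤ 1 := pow_le_one₀ hr.1 hr.2.le
    rw [show (r : ℂ) ^ n.natAbs * circleBasis.repr u n - circleBasis.repr u n
      = ((r ^ n.natAbs - 1 : ℝ) : ℂ) * circleBasis.repr u n by push_cast; ring, norm_mul,
      Complex.norm_real, Real.norm_eq_abs, abs_of_nonpos (by linarith)]
    ring
  have := (Real.continuous_sqrt.tendsto 0).comp hsq
  simpa [Function.comp_def, Real.sqrt_sq (norm_nonneg _)] using this

/-- An absolutely convergent power series in `e^{iθ}`, with its Fourier coefficients. -/
theorem exists_circleL2_of_summable {a : ℕ → ℂ} (ha : Summable fun n => ‖a n‖) :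
    ∃ v : CircleL2, v ∈ hardyCircle ∧ (∀ n : ℕ, circleBasis.repr v (n : ℤ) = a n) ∧
      v =ᵐ[haarTorus] fun θ => ∑' n, a n * expI θ ^ n := by
  have hs : Summable fun n : ℕ => a n • (fourier (n : ℤ) : C(Torus, ℂ)) :=
    Summable.of_norm (by simpa only [norm_smul, fourier_norm, mul_one] using ha)
  set φ : C(Torus, ℂ) := ∑' n : ℕ, a n • (fourier (n : ℤ) : C(Torus, ℂ))
  let toL2 : C(Torus, ℂ) →L[ℂ] CircleL2 := ContinuousMap.toLp 2 haarTorus ℂ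
  have h2 : HasSum (fun n : ℕ => a n • circleBasis (n : ℤ)) (toL2 φ) := by
    have := hs.hasSum.mapL toL2
    simpa [toL2, coe_fourierBasis, fourierLp] using this
  have hrepr : ∀ m : ℤ, HasSum (fun n : ℕ => a n * inner ℂ (circleBasis m) (circleBasis (n : ℤ)))
      (circleBasis.repr (toL2 φ) m) := by
    intro m
    have := h2.mapL (innerSL ℂ (circleBasis m))
    simpa [HilbertBasis.repr_apply_apply, inner_smul_right] using this
  have horth := circleBasis.orthonormal
  rw [orthonormal_iff_ite] at horth
  refine ⟨toL2 φ, ?_, ?_, ?_⟩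
  · exact isClosed_hardyCircle.mem_of_tendsto h2 (.of_forall fun s =>
      Submodule.sum_mem _ fun n _ => Submodule.smul_mem _ _ (circleBasis_mem_hardyCircle n))
  · intro n
    refine (hrepr n).unique ?_
    simp only [horth, Nat.cast_inj]
    refine (hasSum_ite_eq n (a n)).congr_fun fun m => ?_
    rcases eq_or_ne m n with rfl | h
    · simp
    · simp [h, h.symm]
  · filter_upwards [ContinuousMap.coeFn_toLp (p := 2) (𝕜 := ℂ) haarTorus φ] with θ hθ
    rw [hθ]
    have := hs.hasSum.mapL (ContinuousMap.evalCLM ℂ θ)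
    refine (this.tsum_eq.symm).trans ?_
    exact tsum_congr fun n => by
      rw [← fourier_natCast_eq_expI_pow]
      rfl

/-- The `n`-th Taylor coefficient at the origin. -/
def taylorCoeff (g : ℂ → ℂ) (n : ℕ) : ℂ := (n.factorial : ℂ)⁻¹ * iteratedDeriv n g 0

theorem hasSum_taylorCoeff {g : ℂ → ℂ} (hg : DifferentiableOn ℂ g (Metric.ball 0 1)) {z : ℂ}
    (hz : ‖z‖ < 1) : HasSum (fun n => taylorCoeff g n * z ^ n) (g z) := by
  have := Complex.hasSum_taylorSeries_on_ball hg (z := z) (by simpa using hz)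
  refine this.congr_fun fun n => ?_
  rw [taylorCoeff, smul_eq_mul, smul_eq_mul, sub_zero]
  ring

/-- Convergence at the point r is absolute, so the dilated series converges uniformly on the circle.
-/
theorem exists_circleL2_dilate {g : ℂ → ℂ} {a : ℕ → ℂ}
    (hg : ∀ z : ℂ, ‖z‖ < 1 → HasSum (fun n => a n * z ^ n) (g z)) {r : ℝ}
    (hr : r ∈ Set.Ico (0 : ℝ) 1) :
    ∃ v : CircleL2, v ∈ hardyCircle ∧
      (∀ n : ℕ, circleBasis.repr v (n : ℤ) = a n * r ^ n) ∧
      v =ᵐ[haarTorus] fun θ => g (r * expI θ) := by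
  have h1 : ‖(r : ℂ)‖ < 1 := by simpa [abs_of_nonneg hr.1] using hr.2
  obtain ⟨v, h2, h3, h4⟩ := exists_circleL2_of_summable (hg r h1).summable.norm
  refine ⟨v, h2, h3, h4.trans (.of_forall fun θ => ?_)⟩
  have := hg (r * expI θ) (by simpa [norm_expI] using h1)
  simpa [mul_pow, mul_assoc] using this.tsum_eq

/-- The mean value property on circles centred at the origin. -/
theorem integral_dilate {g : ℂ → ℂ} (hg : DifferentiableOn ℂ g (Metric.ball 0 1)) {r : ℝ}
    (hr : r ∈ Set.Ico (0 : ℝ) 1) : ∫ θ, g (r * expI θ) ∂haarTorus = g 0 := by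
  obtain ⟨v, -, h2, h3⟩ := exists_circleL2_dilate (fun _ => hasSum_taylorCoeff hg) hr
  have h4 := h2 0
  rw [fourierBasis_repr, fourierCoeff] at h4
  rw [← integral_congr_ae h3]
  simpa [taylorCoeff] using h4

/-- A holomorphic function whose quadratic means are bounded has its radial boundary function in
the Hardy space. -/
theorem exists_mem_hardyCircle_of_radial {g : ℂ → ℂ}
    (hg : DifferentiableOn ℂ g (Metric.ball 0 1)) {C : ℝ≥0∞} (hC : C ≠ ∞)
    (hb : ∀ r ∈ Set.Ico (0 : ℝ) 1, eLpNorm (fun θ => g (r * expI θ)) 2 haarTorus ≤ C)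
    {G : Torus → ℂ}
    (hG : ∀ᵐ θ ∂haarTorus, Tendsto (fun r : ℝ => g (r * expI θ)) (𝓝[<] 1) (𝓝 (G θ))) :
    ∃ u ∈ hardyCircle, u =ᵐ[haarTorus] G := by
  choose! v hv1 hv2 hv3 using fun r (hr : r ∈ Set.Ico (0 : ℝ) 1) =>
    exists_circleL2_dilate (fun _ => hasSum_taylorCoeff hg) hr
  have hnorm : ∀ r ∈ Set.Ico (0 : ℝ) 1, ‖v r‖ ≤ C.toReal := by
    intro r hr
    rw [Lp.norm_def, eLpNorm_congr_ae (hv3 r hr)]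
    exact ENNReal.toReal_mono hC (hb r hr)
  -- Bessel's inequality for each dilate, with r → 1 in a finite sum, makes the Taylor coefficients
  -- square summable; they then define `u`.
  have hpart : ∀ s : Finset ℕ, ∑ n ∈ s, ‖taylorCoeff g n‖ ^ 2 ≤ C.toReal ^ 2 := by
    intro s
    have hcont : Continuous fun r : ℝ => ∑ n ∈ s, ‖taylorCoeff g n * (r : ℂ) ^ n‖ ^ 2 := by
      fun_prop
    have hlim : Tendsto (fun r : ℝ => ∑ n ∈ s, ‖taylorCoeff g n * (r : ℂ) ^ n‖ ^ 2) (𝓝[<] 1)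
        (𝓝 (∑ n ∈ s, ‖taylorCoeff g n‖ ^ 2)) :=
      Tendsto.mono_left (by simpa using hcont.tendsto 1) nhdsWithin_le_nhds
    refine le_of_tendsto hlim ?_
    filter_upwards [Ico_mem_nhdsLT one_pos] with r hr
    calc ∑ n ∈ s, ‖taylorCoeff g n * (r : ℂ) ^ n‖ ^ 2
        = ∑ n ∈ s.map Nat.castEmbedding, ‖circleBasis.repr (v r) (n : ℤ)‖ ^ 2 := by
          rw [Finset.sum_map]
          exact Finset.sum_congr rfl fun n _ => by simp [hv2 r hr]
      _ ≤ ‖v r‖ ^ 2 := sum_le_hasSum _ (fun _ _ => sq_nonneg _) (norm_sq_eq_tsum_repr _)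
      _ ≤ C.toReal ^ 2 := by gcongr; exact hnorm r hr
  have hsum : Summable fun n => ‖taylorCoeff g n‖ ^ 2 :=
    summable_of_sum_le (fun _ => sq_nonneg _) hpart
  let a : ℤ → ℂ := fun n => if 0 ≤ n then taylorCoeff g n.toNat else 0
  have ha : Memℓp a 2 := by
    refine memℓp_gen ?_
    have : Summable fun n : ℤ => ‖a n‖ ^ 2 := by
      refine (Nat.cast_injective (R := ℤ)).summable_iff ?_ |>.1 ?_
      · intro n hn
        have : ¬ 0 ≤ n := fun h => hn ⟨n.toNat, Int.toNat_of_nonneg h⟩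
        simp [a, this]
      · simpa [a, Function.comp_def] using hsum
    simpa using this
  obtain ⟨u, hu⟩ := circleBasis.repr.surjective ⟨a, ha⟩
  have hua : ∀ n, circleBasis.repr u n = a n := fun n => by rw [hu]
  have hu1 : u ∈ hardyCircle := mem_hardyCircle_iff.2 fun n hn => by
    simp [hua, a, not_le.2 hn]
  have hlim : Tendsto v (𝓝[<] 1) (𝓝 u) := by
    refine tendsto_of_repr_eq_pow_mul fun r hr n => ?_
    rcases le_or_gt 0 n with hn | hn
    · lift n to ℕ using hn
      simp [hua, a, hv2 r hr, mul_comm]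
    · simp [hua, a, mem_hardyCircle_iff.1 (hv1 r hr) n hn, not_le.2 hn]
  refine ⟨u, hu1, ?_⟩
  -- The L² limit is identified with the radial limit along an almost everywhere convergent sequence
  -- of radii.
  obtain ⟨ns, hns, hae⟩ := (tendstoInMeasure_of_tendsto_Lp hlim).exists_seq_tendsto_ae'
  obtain ⟨N, hN⟩ := eventually_atTop.1 (hns.eventually (Ico_mem_nhdsLT (one_pos (α := ℝ))))
  have hcoe : ∀ᵐ θ ∂haarTorus, ∀ k, N ≤ k → v (ns k) θ = g (ns k * expI θ) := by
    rw [ae_all_iff]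
    intro k
    by_cases hk : N ≤ k
    · filter_upwards [hv3 _ (hN k hk)] with θ hθ _ using hθ
    · simp [hk]
  filter_upwards [hae, hcoe, hG] with θ h1 h2 h3
  refine tendsto_nhds_unique h1 ((h3.comp hns).congr' ?_)
  filter_upwards [eventually_ge_atTop N] with k hk using (h2 k hk).symm

/-! ### M. Riesz's inequality and the means of holomorphic functions with positive real part. -/

/-- The pointwise inequality behind the theorem of M. Riesz. -/
theorem exists_norm_rpow_le_re_rpow_sub_re_cpow {p : ℝ} (hp1 : 1 < p) (hp2 : p ≤ 2) :
    ∃ A B : ℝ, 0 ≤ A ∧ 0 ≤ B ∧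
      ∀ w : ℂ, 0 < w.re → ‖w‖ ^ p ≤ A * w.re ^ p - B * (w ^ (p : ℂ)).re := by
  have hpi := Real.pi_pos
  have hp0 : 0 < p := by linarith
  -- The threshold angle makes cos(pφ) negative while cos φ stays positive. With t = arg w, the term
  -- -B cos(pt) suffices for |t| ≥ φ, where p|t| ≤ π because p ≤ 2; the term A cos^p t suffices for
  -- |t| < φ.
  obtain ⟨φ, hφ1, hφ2⟩ : ∃ φ : ℝ, Real.pi / 2 / p < φ ∧ φ < Real.pi / 2 :=
    exists_between (div_lt_self (by positivity) hp1)
  have hφ0 : 0 < φ := lt_trans (by positivity) hφ1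
  have hpφ : Real.pi / 2 < p * φ := by rwa [div_lt_iff₀' hp0] at hφ1
  have hpφ' : p * φ ≤ Real.pi := by nlinarith
  have hκ : Real.cos (p * φ) < 0 :=
    Real.cos_neg_of_pi_div_two_lt_of_lt hpφ (by linarith)
  have hc : 0 < Real.cos φ := Real.cos_pos_of_mem_Ioo ⟨by linarith, hφ2⟩
  have hcp : 0 < Real.cos φ ^ p := Real.rpow_pos_of_pos hc p
  -- `B` is normalised by -B cos(pφ) = 1, and then `A` by A cos^p φ = 1 + B, the 1 + B allowing for
  -- cos(pt) ≤ 1.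
  set B : ℝ := (-Real.cos (p * φ))⁻¹ with hB
  have hB0 : 0 < B := inv_pos.2 (by linarith)
  set A : ℝ := (1 + B) / Real.cos φ ^ p with hA
  have hA0 : 0 < A := by positivity
  have trig : ∀ t : ℝ, |t| < Real.pi / 2 →
      1 ≤ A * Real.cos t ^ p - B * Real.cos (p * t) := by
    intro t ht
    have hct : 0 < Real.cos t := Real.cos_pos_of_mem_Ioo (abs_lt.1 ht)
    rcases le_or_gt φ |t| with h | h
    · have h1 : Real.cos (p * t) ≤ Real.cos (p * φ) := by
        rw [← Real.cos_abs (p * t), abs_mul, abs_of_pos hp0]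
        refine Real.cos_le_cos_of_nonneg_of_le_pi (by positivity) ?_ (by gcongr)
        nlinarith [abs_nonneg t]
      have h2 : B * Real.cos (p * t) ≤ B * Real.cos (p * φ) := by gcongr
      have h3 : B * Real.cos (p * φ) = -1 := by
        rw [hB, inv_neg, neg_mul, inv_mul_cancel₀ hκ.ne]
      have h4 : 0 ≤ A * Real.cos t ^ p := by positivity
      linarith
    · have h1 : Real.cos φ ≤ Real.cos t := by
        rw [← Real.cos_abs t]
        exact Real.cos_le_cos_of_nonneg_of_le_pi (abs_nonneg t) (by linarith) h.le
      have h2 : A * Real.cos φ ^ p ≤ A * Real.cos t ^ p := by gcongr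
      have h3 : A * Real.cos φ ^ p = 1 + B := by rw [hA]; field_simp
      have h4 : B * Real.cos (p * t) ≤ B * 1 := by gcongr; exact Real.cos_le_one _
      linarith
  refine ⟨A, B, hA0.le, hB0.le, fun w hw => ?_⟩
  have hw0 : w ≠ 0 := fun h => by simp [h] at hw
  have hn : 0 < ‖w‖ := norm_pos_iff.2 hw0
  have hre : w.re = ‖w‖ * Real.cos w.arg := (Complex.norm_mul_cos_arg w).symm
  have harg : |w.arg| < Real.pi / 2 := Complex.abs_arg_lt_pi_div_two_iff.2 (Or.inl hw)
  have hcos : 0 < Real.cos w.arg := Real.cos_pos_of_mem_Ioo (abs_lt.1 harg)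
  have hpow : (w ^ (p : ℂ)).re = ‖w‖ ^ p * Real.cos (p * w.arg) := by
    rw [Complex.cpow_ofReal_re, mul_comm p]
  rw [hpow, hre, Real.mul_rpow hn.le hcos.le]
  have h1 : 0 < ‖w‖ ^ p := Real.rpow_pos_of_pos hn p
  nlinarith [mul_le_mul_of_nonneg_left (trig w.arg harg) h1.le]

theorem continuous_dilate {g : ℂ → ℂ} (hg : ContinuousOn g (Metric.ball 0 1)) {r : ℝ}
    (hr : r ∈ Set.Ico (0 : ℝ) 1) : Continuous fun θ => g (r * expI θ) := by
  refine hg.comp_continuous (continuous_const.mul continuous_expI) fun θ => ?_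
  simp [norm_expI, abs_of_nonneg hr.1, hr.2]

/-- As g takes values in the right half-plane, g^p is holomorphic, and its mean over the circle is
g(0)^p. This is nonnegative because g(0) is a positive real, so the `B` term can be dropped after
integration. -/
theorem integral_norm_rpow_dilate_le {p A B : ℝ} (hB : 0 ≤ B)
    (hAB : ∀ w : ℂ, 0 < w.re → ‖w‖ ^ p ≤ A * w.re ^ p - B * (w ^ (p : ℂ)).re) (hp : 0 ≤ p)
    {g : ℂ → ℂ} (hg : DifferentiableOn ℂ g (Metric.ball 0 1))
    (hre : ∀ z ∈ Metric.ball (0 : ℂ) 1, 0 < (g z).re) (him : (g 0).im = 0) {r : ℝ}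
    (hr : r ∈ Set.Ico (0 : ℝ) 1) :
    ∫ θ, ‖g (r * expI θ)‖ ^ p ∂haarTorus ≤ A * ∫ θ, (g (r * expI θ)).re ^ p ∂haarTorus := by
  have hgp : DifferentiableOn ℂ (fun z => g z ^ (p : ℂ)) (Metric.ball 0 1) :=
    hg.cpow_const fun z hz => Or.inl (hre z hz)
  have hmem : ∀ θ : Torus, (r : ℂ) * expI θ ∈ Metric.ball (0 : ℂ) 1 := fun θ => by
    simp [norm_expI, abs_of_nonneg hr.1, hr.2]
  have hint : ∀ {E : Type} [NormedAddCommGroup E] {f : Torus → E}, Continuous f →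
      Integrable f haarTorus := fun hf =>
    hf.integrable_of_hasCompactSupport (HasCompactSupport.of_compactSpace _)
  have hc := continuous_dilate hg.continuousOn hr
  have hcp := hint (continuous_dilate hgp.continuousOn hr)
  have h1 : Continuous fun θ => ‖g (r * expI θ)‖ ^ p := hc.norm.rpow_const fun _ => Or.inr hp
  have h2 : Continuous fun θ => (g (r * expI θ)).re ^ p :=
    (Complex.continuous_re.comp hc).rpow_const fun _ => Or.inr hp
  have hcr : Integrable (fun θ => (g (r * expI θ) ^ (p : ℂ)).re) haarTorus := hcp.re
  have hmean := congrArg Complex.re (integral_dilate hgp hr)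
  have hswap : ∫ θ, (g (r * expI θ) ^ (p : ℂ)).re ∂haarTorus = (g 0 ^ (p : ℂ)).re := by
    rw [← hmean]
    exact integral_re hcp
  have h0 : 0 ≤ (g 0 ^ (p : ℂ)).re := by
    have hpos := hre 0 (by simp)
    have : g 0 = ((g 0).re : ℂ) := Complex.ext rfl (by simpa using him)
    rw [this, ← Complex.ofReal_cpow hpos.le, Complex.ofReal_re]
    positivity
  calc ∫ θ, ‖g (r * expI θ)‖ ^ p ∂haarTorus
      ≤ ∫ θ, (A * (g (r * expI θ)).re ^ p - B * (g (r * expI θ) ^ (p : ℂ)).re) ∂haarTorus :=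
        integral_mono (hint h1) (((hint h2).const_mul A).sub (hcr.const_mul B))
          fun θ => hAB _ (hre _ (hmem θ))
    _ = A * ∫ θ, (g (r * expI θ)).re ^ p ∂haarTorus - B * (g 0 ^ (p : ℂ)).re := by
        rw [integral_sub ((hint h2).const_mul A) (hcr.const_mul B), integral_const_mul,
          integral_const_mul, hswap]
    _ ≤ _ := sub_le_self _ (mul_nonneg hB h0)

theorem eLpNorm_dilate_le {p A B : ℝ} (hA : 0 ≤ A) (hB : 0 ≤ B)
    (hAB : ∀ w : ℂ, 0 < w.re → ‖w‖ ^ p ≤ A * w.re ^ p - B * (w ^ (p : ℂ)).re) (hp : 0 < p)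
    {g : ℂ → ℂ} (hg : DifferentiableOn ℂ g (Metric.ball 0 1))
    (hre : ∀ z ∈ Metric.ball (0 : ℂ) 1, 0 < (g z).re) (him : (g 0).im = 0) {r : ℝ}
    (hr : r ∈ Set.Ico (0 : ℝ) 1) :
    eLpNorm (fun θ => g (r * expI θ)) (ENNReal.ofReal p) haarTorus ≤
      ENNReal.ofReal (A ^ p⁻¹) *
        eLpNorm (fun θ => (g (r * expI θ)).re) (ENNReal.ofReal p) haarTorus := by
  have hc := continuous_dilate hg.continuousOn hr
  have hmem : ∀ {E : Type} [NormedAddCommGroup E] {f : Torus → E}, Continuous f →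
      MemLp f (ENNReal.ofReal p) haarTorus := fun hf =>
    hf.memLp_of_hasCompactSupport (HasCompactSupport.of_compactSpace _)
  have hp0 : ENNReal.ofReal p ≠ 0 := by simpa using hp
  rw [(hmem hc).eLpNorm_eq_integral_rpow_norm hp0 (by simp),
    (hmem (f := fun θ => (g (r * expI θ)).re) (Complex.continuous_re.comp hc)).eLpNorm_eq_integral_rpow_norm hp0 (by simp),
    ENNReal.toReal_ofReal hp.le, ← ENNReal.ofReal_mul (by positivity),
    ← Real.mul_rpow hA (integral_nonneg fun _ => by positivity)]
  refine ENNReal.ofReal_le_ofReal (Real.rpow_le_rpow (integral_nonneg fun _ => by positivity) ?_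
    (by positivity))
  refine (integral_norm_rpow_dilate_le hB hAB hp.le hg hre him hr).trans_eq ?_
  congr 1
  refine integral_congr_ae (.of_forall fun θ => ?_)
  have : 0 < (g (r * expI θ)).re := hre _ (by simp [norm_expI, abs_of_nonneg hr.1, hr.2])
  simp [abs_of_pos this]

/-! ### The Cauchy transform and the positivity of its real part. -/

/-- The Cauchy integral of `u`, as a power series. -/
def cauchyTransform (u : CircleL2) (z : ℂ) : ℂ := ∑' n : ℕ, circleBasis.repr u (n : ℤ) * z ^ n

theorem norm_repr_le (u : CircleL2) (n : ℤ) : ‖circleBasis.repr u n‖ ≤ ‖u‖ := by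
  rw [HilbertBasis.repr_apply_apply]
  refine (norm_inner_le_norm _ _).trans ?_
  rw [circleBasis.orthonormal.1 n, one_mul]

theorem norm_repr_mul_pow_le (u : CircleL2) (n : ℕ) {z : ℂ} {ρ : ℝ} (hz : ‖z‖ ≤ ρ) :
    ‖circleBasis.repr u (n : ℤ) * z ^ n‖ ≤ ‖u‖ * ρ ^ n := by
  rw [norm_mul, norm_pow]
  gcongr
  exact norm_repr_le u n

theorem hasSum_cauchyTransform (u : CircleL2) {z : ℂ} (hz : ‖z‖ < 1) :
    HasSum (fun n : ℕ => circleBasis.repr u (n : ℤ) * z ^ n) (cauchyTransform u z) := by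
  refine (Summable.of_norm_bounded (g := fun n => ‖u‖ * ‖z‖ ^ n)
    ((summable_geometric_of_lt_one (norm_nonneg z) hz).mul_left _) fun n => ?_).hasSum
  exact norm_repr_mul_pow_le u n le_rfl

theorem differentiableOn_cauchyTransform (u : CircleL2) :
    DifferentiableOn ℂ (cauchyTransform u) (Metric.ball 0 1) := by
  intro z hz
  rw [mem_ball_zero_iff] at hz
  obtain ⟨ρ, hzρ, hρ⟩ := exists_between hz
  have hρ0 : 0 ≤ ρ := (norm_nonneg z).trans hzρ.le
  have : DifferentiableOn ℂ (cauchyTransform u) (Metric.ball 0 ρ) := by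
    refine Complex.differentiableOn_tsum_of_summable_norm (u := fun n => ‖u‖ * ρ ^ n)
      ((summable_geometric_of_lt_one hρ0 hρ).mul_left _) (fun n => by fun_prop)
      Metric.isOpen_ball fun n w hw => ?_
    exact norm_repr_mul_pow_le u n (mem_ball_zero_iff.1 hw).le
  exact (this.differentiableAt (Metric.isOpen_ball.mem_nhds (by simpa using hzρ)))
    |>.differentiableWithinAt

theorem integrable_circleL2 (u : CircleL2) : Integrable u haarTorus :=
  (Lp.memLp u).integrable one_le_two

theorem repr_natCast_eq_integral (u : CircleL2) (n : ℕ) :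
    circleBasis.repr u (n : ℤ) = ∫ θ, (starRingEnd ℂ (expI θ)) ^ n * u θ ∂haarTorus := by
  rw [fourierBasis_repr, fourierCoeff]
  refine integral_congr_ae (.of_forall fun θ => ?_)
  simp only [fourier_neg, fourier_natCast_eq_expI_pow, map_pow, smul_eq_mul]

theorem cauchyTransform_eq_integral (u : CircleL2) {z : ℂ} (hz : ‖z‖ < 1) :
    cauchyTransform u z = ∫ θ, (1 - z * starRingEnd ℂ (expI θ))⁻¹ * u θ ∂haarTorus := by
  have hw : ∀ θ, ‖z * starRingEnd ℂ (expI θ)‖ = ‖z‖ := fun θ => by simp [norm_expI]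
  have hcont : Continuous fun θ => z * starRingEnd ℂ (expI θ) :=
    continuous_const.mul (Complex.continuous_conj.comp continuous_expI)
  have hu := integrable_circleL2 u
  have hint : ∀ n : ℕ, Integrable (fun θ => (z * starRingEnd ℂ (expI θ)) ^ n * u θ)
      haarTorus := fun n =>
    hu.bdd_mul (c := ‖z‖ ^ n) (hcont.pow n).aestronglyMeasurable
      (.of_forall fun θ => by rw [norm_pow, hw])
  have hsum := hasSum_integral_of_summable_integral_norm hint (by
    simp only [norm_mul, norm_pow, RCLike.norm_conj, norm_expI, mul_one, integral_const_mul]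
    exact (summable_geometric_of_lt_one (norm_nonneg z) hz).mul_right _)
  refine (hasSum_cauchyTransform u hz).unique ?_
  have hlim : ∫ θ, (1 - z * starRingEnd ℂ (expI θ))⁻¹ * u θ ∂haarTorus =
      ∫ θ, ∑' n : ℕ, (z * starRingEnd ℂ (expI θ)) ^ n * u θ ∂haarTorus := by
    refine integral_congr_ae (.of_forall fun θ => ?_)
    simp only [tsum_mul_right]
    rw [tsum_geometric_of_norm_lt_one (by rwa [hw])]
  rw [hlim]
  refine hsum.congr_fun fun n => ?_
  rw [repr_natCast_eq_integral, mul_comm, ← integral_const_mul]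
  simp only [mul_pow, mul_assoc]

/-- The map 1/(1 - w) sends the unit disc to the half-plane Re > 1/2. -/
theorem half_le_re_inv_one_sub {w : ℂ} (hw : ‖w‖ < 1) : 1 / 2 ≤ ((1 - w)⁻¹).re := by
  have h1 : w.re < 1 := (Complex.re_le_norm w).trans_lt hw
  have h2 : w.re ^ 2 + w.im ^ 2 < 1 := by
    have h3 := Complex.sq_norm w
    rw [Complex.normSq_apply] at h3
    nlinarith [norm_nonneg w]
  rw [Complex.inv_re, Complex.normSq_apply]
  simp only [Complex.sub_re, Complex.one_re, Complex.sub_im, Complex.one_im]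
  have hpos : 0 < (1 - w.re) * (1 - w.re) + (0 - w.im) * (0 - w.im) := by nlinarith
  rw [div_le_div_iff₀ two_pos hpos]
  nlinarith

/-- The Cauchy kernel has real part at least 1/2. If f has positive mean, the bound is strictly
positive, as is needed to take the power g^p. -/
theorem re_cauchyTransform_ge {u : CircleL2} {f : Torus → ℝ} (hf : ∀ θ, 0 ≤ f θ)
    (huf : u =ᵐ[haarTorus] fun θ => (f θ : ℂ)) {z : ℂ} (hz : ‖z‖ < 1) :
    (∫ θ, f θ ∂haarTorus) / 2 ≤ (cauchyTransform u z).re := by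
  have hw : ∀ θ, ‖z * starRingEnd ℂ (expI θ)‖ < 1 := fun θ => by simpa [norm_expI] using hz
  have hcont : Continuous fun θ => (1 - z * starRingEnd ℂ (expI θ))⁻¹ :=
    (continuous_const.sub (continuous_const.mul
      (Complex.continuous_conj.comp continuous_expI))).inv₀ fun θ h => by
        have := hw θ
        have h1 : 1 - z * starRingEnd ℂ (expI θ) = 0 := h
        rw [← sub_eq_zero.1 h1] at this
        simp at this
  obtain ⟨C, hC⟩ := (isCompact_range hcont).isBounded.exists_norm_le
  have hu := (integrable_circleL2 u).congr huf
  have hfi : Integrable f haarTorus := by simpa using hu.re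
  have hint : Integrable (fun θ => (1 - z * starRingEnd ℂ (expI θ))⁻¹ * (f θ : ℂ)) haarTorus :=
    hu.bdd_mul (c := C) hcont.aestronglyMeasurable (.of_forall fun θ => hC _ ⟨θ, rfl⟩)
  have hre : (cauchyTransform u z).re =
      ∫ θ, ((1 - z * starRingEnd ℂ (expI θ))⁻¹ * (f θ : ℂ)).re ∂haarTorus := by
    rw [cauchyTransform_eq_integral u hz,
      integral_congr_ae (g := fun θ => (1 - z * starRingEnd ℂ (expI θ))⁻¹ * (f θ : ℂ))]
    · exact (integral_re hint).symm
    · filter_upwards [huf] with θ hθ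
      rw [hθ]
  rw [hre, ← integral_div]
  refine integral_mono (hfi.div_const 2) hint.re fun θ => ?_
  have := mul_le_mul_of_nonneg_right (half_le_re_inv_one_sub (hw θ)) (hf θ)
  simpa [div_eq_inv_mul] using this

theorem cauchyTransform_zero (u : CircleL2) :
    cauchyTransform u 0 = circleBasis.repr u 0 := by
  have := (hasSum_cauchyTransform u (z := 0) (by simp)).unique
    (hasSum_single 0 fun n hn => by simp [hn])
  simpa using this

/-! ### The theorem of M. Riesz for exponents at most two. -/

theorem repr_star (u : CircleL2) (n : ℤ) :
    circleBasis.repr (star u) n = starRingEnd ℂ (circleBasis.repr u (-n)) := by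
  rw [fourierBasis_repr, fourierBasis_repr, fourierCoeff, fourierCoeff, ← integral_conj]
  refine integral_congr_ae ?_
  filter_upwards [Lp.coeFn_star u] with θ hθ
  rw [hθ]
  simp

/-- For real `u` the real part of its Riesz projection is `(u + c) / 2`, with `c` its mean. -/
theorem rieszProjection_add_star {u : CircleL2} (hu : star u = u) :
    rieszProjection u + star (rieszProjection u) =
      u + circleBasis.repr u 0 • circleBasis 0 := by
  have hconj : ∀ n, starRingEnd ℂ (circleBasis.repr u (-n)) = circleBasis.repr u n := fun n => by
    rw [← repr_star, hu]
  have horth := circleBasis.orthonormal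
  rw [orthonormal_iff_ite] at horth
  refine circleL2_ext fun n => ?_
  have h0 : circleBasis.repr (circleBasis 0) n = if n = 0 then 1 else 0 := by
    rw [HilbertBasis.repr_apply_apply, horth]
  rw [map_add, map_add, map_smul, lp.coeFn_add, lp.coeFn_add, lp.coeFn_smul, Pi.add_apply,
    Pi.add_apply, Pi.smul_apply, repr_star, repr_rieszProjection, repr_rieszProjection, h0]
  rcases lt_trichotomy n 0 with h | rfl | h
  · rw [if_neg (not_le.2 h), if_pos (by omega), if_neg h.ne, hconj]
    simp
  · have := hconj 0
    rw [neg_zero] at this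
    simp [this]
  · rw [if_pos h.le, if_neg (by omega), if_neg h.ne']
    simp

/-- Twice the real part is u plus its mean, and on a probability space the mean is at most the L^p
norm. -/
theorem eLpNorm_re_rieszProjection_le {u : CircleL2} (hu : star u = u) {p : ℝ≥0∞} (hp : 1 ≤ p) :
    eLpNorm (fun θ => (rieszProjection u θ).re) p haarTorus ≤ eLpNorm u p haarTorus := by
  set v := rieszProjection u
  set c := circleBasis.repr u 0
  have hum := Lp.aestronglyMeasurable u
  have hc : ‖c‖ₑ ≤ eLpNorm u p haarTorus := by
    have h1 : c = ∫ θ, u θ ∂haarTorus := by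
      have := repr_natCast_eq_integral u 0
      simpa [c] using this
    rw [h1]
    refine (enorm_integral_le_lintegral_enorm _).trans ?_
    rw [← eLpNorm_one_eq_lintegral_enorm]
    exact eLpNorm_le_eLpNorm_of_exponent_le hp hum
  have hae : (fun θ => 2 * ((v θ).re : ℂ)) =ᵐ[haarTorus] fun θ => u θ + c := by
    have h1 : ((v + star v : CircleL2) : Torus → ℂ) =ᵐ[haarTorus]
        (u + c • circleBasis 0 : CircleL2) := by rw [rieszProjection_add_star hu]
    have h3 : ((circleBasis 0 : CircleL2) : Torus → ℂ) =ᵐ[haarTorus] fun _ => 1 := by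
      rw [coe_fourierBasis]
      exact (coeFn_fourierLp 2 0).trans (.of_forall fun θ => by simp)
    filter_upwards [h1, h3, Lp.coeFn_add v (star v), Lp.coeFn_star v,
      Lp.coeFn_add u (c • circleBasis 0), Lp.coeFn_smul c (circleBasis 0)] with θ h1 h3 h4 h5 h6 h7
    rw [h4, h6, Pi.add_apply, Pi.add_apply, h5, h7, Pi.smul_apply, h3, Pi.star_apply] at h1
    rw [smul_eq_mul, mul_one] at h1
    rw [← h1]
    have h8 := Complex.add_conj (v θ)
    push_cast at h8
    exact h8.symm
  have h2 : 2 * eLpNorm (fun θ => (v θ).re) p haarTorus ≤ 2 * eLpNorm u p haarTorus := by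
    calc 2 * eLpNorm (fun θ => (v θ).re) p haarTorus
        = eLpNorm (fun θ => (2 : ℝ) • (v θ).re) p haarTorus := by
          rw [show (fun θ => (2 : ℝ) • (v θ).re) = (2 : ℝ) • fun θ => (v θ).re from rfl,
            eLpNorm_const_smul]
          simp [← ofReal_norm]
      _ = eLpNorm (fun θ => u θ + c) p haarTorus := by
          rw [← eLpNorm_congr_ae hae]
          exact eLpNorm_congr_norm_ae (.of_forall fun θ => by simp)
      _ ≤ eLpNorm u p haarTorus + eLpNorm (fun _ => c) p haarTorus :=
          eLpNorm_add_le hum aestronglyMeasurable_const hp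
      _ ≤ eLpNorm u p haarTorus + eLpNorm u p haarTorus := by
          gcongr
          rw [eLpNorm_const c (by positivity) (NeZero.ne _)]
          simpa using hc
      _ = 2 * eLpNorm u p haarTorus := (two_mul _).symm
  exact (ENNReal.mul_le_mul_iff_right (by simp) (by simp)).1 h2

theorem eLpNorm_coe_le_ofReal_norm {p : ℝ≥0∞} (hp : p ≤ 2) (u : CircleL2) :
    eLpNorm u p haarTorus ≤ ENNReal.ofReal ‖u‖ := by
  rw [Lp.norm_def, ENNReal.ofReal_toReal (Lp.eLpNorm_ne_top u)]
  exact eLpNorm_le_eLpNorm_of_exponent_le hp (Lp.aestronglyMeasurable u)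

/-- For p ≤ 2 the L² distance dominates the L^p distance, so L² convergence of Abel means suffices
for L^p bounds. -/
theorem eLpNorm_coe_le_add {p : ℝ≥0∞} (hp : 1 ≤ p) (hp' : p ≤ 2) (u v : CircleL2) :
    eLpNorm u p haarTorus ≤ eLpNorm v p haarTorus + ENNReal.ofReal ‖u - v‖ := by
  calc eLpNorm u p haarTorus
      = eLpNorm (fun θ => v θ + (u - v : CircleL2) θ) p haarTorus := by
        refine eLpNorm_congr_ae ?_
        filter_upwards [Lp.coeFn_sub u v] with θ h
        rw [h]
        simp
    _ ≤ eLpNorm v p haarTorus + eLpNorm (u - v : CircleL2) p haarTorus :=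
        eLpNorm_add_le (Lp.aestronglyMeasurable _) (Lp.aestronglyMeasurable _) hp
    _ ≤ _ := by
        gcongr
        exact eLpNorm_coe_le_ofReal_norm hp' _

theorem eLpNorm_re_coe_le_add {p : ℝ≥0∞} (hp : 1 ≤ p) (hp' : p ≤ 2) (u v : CircleL2) :
    eLpNorm (fun θ => (u θ).re) p haarTorus ≤
      eLpNorm (fun θ => (v θ).re) p haarTorus + ENNReal.ofReal ‖u - v‖ := by
  have hm : ∀ w : CircleL2, AEStronglyMeasurable (fun θ => (w θ).re) haarTorus := fun w =>
    Complex.continuous_re.comp_aestronglyMeasurable (Lp.aestronglyMeasurable w)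
  calc eLpNorm (fun θ => (u θ).re) p haarTorus
      = eLpNorm (fun θ => (v θ).re + ((u - v : CircleL2) θ).re) p haarTorus := by
        refine eLpNorm_congr_ae ?_
        filter_upwards [Lp.coeFn_sub u v] with θ h
        rw [h]
        simp
    _ ≤ eLpNorm (fun θ => (v θ).re) p haarTorus
          + eLpNorm (fun θ => ((u - v : CircleL2) θ).re) p haarTorus :=
        eLpNorm_add_le (hm _) (hm _) hp
    _ ≤ _ := by
        gcongr
        refine (eLpNorm_mono fun θ => ?_).trans (eLpNorm_coe_le_ofReal_norm hp' _)
        exact Complex.abs_re_le_norm _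

/-- The theorem of M. Riesz for nonnegative functions and exponents at most two. -/
theorem eLpNorm_rieszProjection_le_of_nonneg {p A B : ℝ} (hA : 0 ≤ A) (hB : 0 ≤ B)
    (hAB : ∀ w : ℂ, 0 < w.re → ‖w‖ ^ p ≤ A * w.re ^ p - B * (w ^ (p : ℂ)).re)
    (hp1 : 1 < p) (hp2 : p ≤ 2) {u : CircleL2} {f : Torus → ℝ} (hf : ∀ θ, 0 ≤ f θ)
    (huf : u =ᵐ[haarTorus] fun θ => (f θ : ℂ)) :
    eLpNorm (rieszProjection u) (ENNReal.ofReal p) haarTorus ≤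
      ENNReal.ofReal (A ^ p⁻¹) * eLpNorm u (ENNReal.ofReal p) haarTorus := by
  have hp1' : 1 ≤ ENNReal.ofReal p := by simpa using hp1.le
  have hp2' : ENNReal.ofReal p ≤ 2 := by simpa using ENNReal.ofReal_le_ofReal hp2
  have hfi : Integrable f haarTorus := by simpa using ((integrable_circleL2 u).congr huf).re
  have hstar : star u = u := Lp.ext <| by
    filter_upwards [Lp.coeFn_star u, huf] with θ h1 h2
    rw [h1, Pi.star_apply, h2]
    exact Complex.conj_ofReal _
  -- Mean zero forces u = 0; it is set apart because strict positivity of Re g would fail.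
  rcases (integral_nonneg hf : 0 ≤ ∫ θ, f θ ∂haarTorus).eq_or_lt with h0 | hpos
  · have hf0 : f =ᵐ[haarTorus] 0 := (integral_eq_zero_iff_of_nonneg hf hfi).1 h0.symm
    have hu0 : u = 0 := Lp.ext <| by
      filter_upwards [huf, hf0, Lp.coeFn_zero ℂ 2 haarTorus] with θ h1 h2 h3
      rw [h1, h2, h3]
      simp
    have : eLpNorm (rieszProjection u) (ENNReal.ofReal p) haarTorus = 0 := by
      rw [hu0, map_zero, eLpNorm_congr_ae (Lp.coeFn_zero ℂ 2 haarTorus), eLpNorm_zero]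
    rw [this]
    exact zero_le
  set g := cauchyTransform u
  have hg : DifferentiableOn ℂ g (Metric.ball 0 1) := differentiableOn_cauchyTransform u
  have hre : ∀ z ∈ Metric.ball (0 : ℂ) 1, 0 < (g z).re := fun z hz =>
    lt_of_lt_of_le (by positivity) (re_cauchyTransform_ge hf huf (by simpa using hz))
  have him : (g 0).im = 0 := by
    rw [show g 0 = circleBasis.repr u 0 from cauchyTransform_zero u, ← Complex.conj_eq_iff_im]
    have := repr_star u 0
    rwa [hstar, neg_zero, eq_comm] at this
  choose! v hv1 hv2 hv3 using fun r (hr : r ∈ Set.Ico (0 : ℝ) 1) =>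
    exists_circleL2_dilate (fun _ => hasSum_cauchyTransform u) hr
  have hlim : Tendsto v (𝓝[<] 1) (𝓝 (rieszProjection u)) := by
    refine tendsto_of_repr_eq_pow_mul fun r hr n => ?_
    rw [repr_rieszProjection]
    rcases le_or_gt 0 n with hn | hn
    · lift n to ℕ using hn
      simp only [hv2 r hr, Int.natAbs_natCast, Int.natCast_nonneg, if_true, mul_comm]
    · rw [mem_hardyCircle_iff.1 (hv1 r hr) n hn, if_neg (not_le.2 hn), mul_zero]
  have hdist : Tendsto (fun r => ENNReal.ofReal ‖rieszProjection u - v r‖) (𝓝[<] 1) (𝓝 0) := by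
    have h1 := ENNReal.tendsto_ofReal ((tendsto_const_nhds (x := rieszProjection u)).sub hlim).norm
    simpa using h1
  set K := ENNReal.ofReal (A ^ p⁻¹)
  set N := eLpNorm u (ENNReal.ofReal p) haarTorus
  -- The first error replaces the real part on radius r by its boundary value, the second replaces
  -- the projection by its dilate; both vanish as r → 1.
  have hbound : ∀ᶠ r in 𝓝[<] (1 : ℝ),
      eLpNorm (rieszProjection u) (ENNReal.ofReal p) haarTorus ≤
        K * (N + ENNReal.ofReal ‖rieszProjection u - v r‖)
          + ENNReal.ofReal ‖rieszProjection u - v r‖ := by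
    filter_upwards [Ico_mem_nhdsLT one_pos] with r hr
    refine (eLpNorm_coe_le_add hp1' hp2' _ (v r)).trans (add_le_add_left ?_ _)
    calc eLpNorm (v r) (ENNReal.ofReal p) haarTorus
        = eLpNorm (fun θ => g (r * expI θ)) (ENNReal.ofReal p) haarTorus :=
          eLpNorm_congr_ae (hv3 r hr)
      _ ≤ K * eLpNorm (fun θ => (g (r * expI θ)).re) (ENNReal.ofReal p) haarTorus :=
          eLpNorm_dilate_le hA hB hAB (by linarith) hg hre him hr
      _ = K * eLpNorm (fun θ => (v r θ).re) (ENNReal.ofReal p) haarTorus := by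
          congr 1
          refine eLpNorm_congr_ae ?_
          filter_upwards [hv3 r hr] with θ h
          rw [h]
      _ ≤ _ := by
          gcongr
          refine (eLpNorm_re_coe_le_add hp1' hp2' _ (rieszProjection u)).trans ?_
          rw [norm_sub_rev]
          gcongr
          exact eLpNorm_re_rieszProjection_le hstar hp1'
  refine ge_of_tendsto ?_ hbound
  have h1 : Tendsto (fun r => K * (N + ENNReal.ofReal ‖rieszProjection u - v r‖)
      + ENNReal.ofReal ‖rieszProjection u - v r‖) (𝓝[<] 1) (𝓝 (K * (N + 0) + 0)) :=
    (ENNReal.Tendsto.const_mul (tendsto_const_nhds.add hdist) (Or.inr ENNReal.ofReal_ne_top)).add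
      hdist
  simpa using h1

/-- The theorem of M. Riesz for exponents at most two. -/
theorem exists_eLpNorm_rieszProjection_le_of_le_two {p : ℝ} (hp1 : 1 < p) (hp2 : p ≤ 2) :
    ∃ C : ℝ≥0∞, C ≠ ∞ ∧ ∀ u : CircleL2,
      eLpNorm (rieszProjection u) (ENNReal.ofReal p) haarTorus ≤
        C * eLpNorm u (ENNReal.ofReal p) haarTorus := by
  obtain ⟨A, B, hA, hB, hAB⟩ := exists_norm_rpow_le_re_rpow_sub_re_cpow hp1 hp2
  have hp1' : 1 ≤ ENNReal.ofReal p := by simpa using hp1.le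
  set K := ENNReal.ofReal (A ^ p⁻¹)
  refine ⟨4 * K, ENNReal.mul_ne_top (by simp) ENNReal.ofReal_ne_top, fun u => ?_⟩
  -- Used for the positive and negative parts of Re u and Im u; these four pieces explain the
  -- constant `4 * K`.
  have piece : ∀ φ : ℂ → ℝ, Continuous φ → (∀ z, 0 ≤ φ z) → (∀ z, φ z ≤ ‖z‖) →
      ∃ w : CircleL2, w =ᵐ[haarTorus] (fun θ => (φ (u θ) : ℂ)) ∧
        eLpNorm (rieszProjection w) (ENNReal.ofReal p) haarTorus ≤
          K * eLpNorm u (ENNReal.ofReal p) haarTorus := by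
    intro φ hφ h0 h1
    have hle : ∀ θ, ‖(φ (u θ) : ℂ)‖ ≤ ‖u θ‖ := fun θ => by
      rw [Complex.norm_real, Real.norm_of_nonneg (h0 _)]
      exact h1 _
    have hmem : MemLp (fun θ => (φ (u θ) : ℂ)) 2 haarTorus :=
      (Lp.memLp u).mono ((Complex.continuous_ofReal.comp hφ).comp_aestronglyMeasurable
        (Lp.aestronglyMeasurable u)) (.of_forall hle)
    refine ⟨hmem.toLp _, hmem.coeFn_toLp, ?_⟩
    refine (eLpNorm_rieszProjection_le_of_nonneg hA hB hAB hp1 hp2 (fun θ => h0 (u θ))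
      hmem.coeFn_toLp).trans ?_
    gcongr
    rw [eLpNorm_congr_ae hmem.coeFn_toLp]
    exact eLpNorm_mono hle
  obtain ⟨w1, h1, b1⟩ := piece (fun z => max z.re 0) (by fun_prop) (fun z => le_max_right _ _)
    fun z => max_le (Complex.re_le_norm z) (norm_nonneg z)
  obtain ⟨w2, h2, b2⟩ := piece (fun z => max (-z.re) 0) (by fun_prop) (fun z => le_max_right _ _)
    fun z => max_le ((neg_le_abs _).trans (Complex.abs_re_le_norm z)) (norm_nonneg z)
  obtain ⟨w3, h3, b3⟩ := piece (fun z => max z.im 0) (by fun_prop) (fun z => le_max_right _ _)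
    fun z => max_le (Complex.im_le_norm z) (norm_nonneg z)
  obtain ⟨w4, h4, b4⟩ := piece (fun z => max (-z.im) 0) (by fun_prop) (fun z => le_max_right _ _)
    fun z => max_le ((neg_le_abs _).trans (Complex.abs_im_le_norm z)) (norm_nonneg z)
  have hu : u = (w1 - w2) + Complex.I • (w3 - w4) := Lp.ext <| by
    filter_upwards [h1, h2, h3, h4, Lp.coeFn_sub w1 w2, Lp.coeFn_sub w3 w4,
      Lp.coeFn_add (w1 - w2) (Complex.I • (w3 - w4)), Lp.coeFn_smul Complex.I (w3 - w4)]
      with θ h1 h2 h3 h4 h5 h6 h7 h8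
    rw [h7, Pi.add_apply, h8, Pi.smul_apply, h5, h6, Pi.sub_apply, Pi.sub_apply, h1, h2, h3, h4]
    have key : ∀ x : ℝ, max x 0 - max (-x) 0 = x := max_zero_sub_max_neg_zero_eq_self
    rw [← Complex.ofReal_sub, ← Complex.ofReal_sub, key, key, smul_eq_mul, mul_comm Complex.I]
    exact (Complex.re_add_im _).symm
  have hm := fun w : CircleL2 => Lp.aestronglyMeasurable (rieszProjection w)
  have hae : rieszProjection u =ᵐ[haarTorus]
      (rieszProjection w1 - rieszProjection w2 : Torus → ℂ)
        + Complex.I • (rieszProjection w3 - rieszProjection w4 : Torus → ℂ) := by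
    rw [hu, map_add, map_smul, map_sub, map_sub]
    refine (Lp.coeFn_add _ _).trans ((Lp.coeFn_sub _ _).add ?_)
    exact (Lp.coeFn_smul _ _).trans ((Lp.coeFn_sub _ _).const_smul _)
  rw [eLpNorm_congr_ae hae]
  refine (eLpNorm_add_le ((hm _).sub (hm _)) (((hm _).sub (hm _)).const_smul _) hp1').trans ?_
  rw [eLpNorm_const_smul]
  have hI : ‖Complex.I‖ₑ = 1 := by simp [← ofReal_norm]
  rw [hI, one_mul]
  refine (add_le_add (eLpNorm_sub_le (hm _) (hm _) hp1')
    (eLpNorm_sub_le (hm _) (hm _) hp1')).trans ?_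
  refine (add_le_add (add_le_add b1 b2) (add_le_add b3 b4)).trans_eq ?_
  ring

/-! ### Exponents above two, by duality. -/

/-- The duality estimate, for a bounded truncation of the projection. -/
theorem eLpNorm_indicator_rieszProjection_le {p q : ℝ} (hpq : p.HolderConjugate q) (hp : 2 ≤ p)
    {C : ℝ≥0∞} (hC : ∀ u : CircleL2,
      eLpNorm (rieszProjection u) (ENNReal.ofReal q) haarTorus ≤
        C * eLpNorm u (ENNReal.ofReal q) haarTorus) (u : CircleL2) (N : ℕ) :
    eLpNorm ({θ | ‖rieszProjection u θ‖ ≤ N}.indicator (rieszProjection u))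
      (ENNReal.ofReal p) haarTorus ≤ C * eLpNorm u (ENNReal.ofReal p) haarTorus := by
  set v := rieszProjection u with hv
  have hp0 : 0 < p := by linarith
  have hq0 : 0 < q := hpq.symm.pos
  have hP0 : ENNReal.ofReal p ≠ 0 := by simpa using hp0
  have hQ0 : ENNReal.ofReal q ≠ 0 := by simpa using hq0
  have hvm : StronglyMeasurable v := Lp.stronglyMeasurable v
  set w : Torus → ℂ := {θ | ‖v θ‖ ≤ N}.indicator v with hw
  have hs : MeasurableSet {θ | ‖v θ‖ ≤ (N : ℝ)} :=
    measurableSet_le hvm.measurable.norm measurable_const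
  have hwm : Measurable w := hvm.measurable.indicator hs
  have hwN : ∀ θ, ‖w θ‖ ≤ N := fun θ => by
    by_cases h : ‖v θ‖ ≤ N
    · simpa [hw, Set.indicator_of_mem (show θ ∈ {θ | ‖v θ‖ ≤ (N : ℝ)} from h)] using h
    · simp [hw, Set.indicator_of_notMem (show θ ∉ {θ | ‖v θ‖ ≤ (N : ℝ)} from h)]
  -- The extremal function of Hölder's inequality: |g|^q = |w|^p, while pairing with `v` gives the
  -- integral of |w|^p. Truncation puts it in L² and makes `Y` finite.
  set g : Torus → ℂ := fun θ => ((‖w θ‖ ^ (p - 2) : ℝ) : ℂ) * w θ with hg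
  have hgm : Measurable g := (Complex.measurable_ofReal.comp (hwm.norm.pow_const _)).mul hwm
  have hgn : ∀ θ, ‖g θ‖ = ‖w θ‖ ^ (p - 1) := fun θ => by
    rw [hg]
    simp only [norm_mul, Complex.norm_real, Real.norm_of_nonneg (Real.rpow_nonneg (norm_nonneg _) _)]
    rcases (norm_nonneg (w θ)).eq_or_lt with h | h
    · rw [← h, mul_zero, Real.zero_rpow (by linarith)]
    · rw [← Real.rpow_add_one h.ne']
      congr 1
      ring
  have hgmem : MemLp g 2 haarTorus :=
    MemLp.of_bound hgm.aestronglyMeasurable ((N : ℝ) ^ (p - 1)) (.of_forall fun θ => by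
      rw [hgn]
      exact Real.rpow_le_rpow (norm_nonneg _) (hwN θ) (by linarith))
  set Y : ℝ≥0∞ := ∫⁻ θ, ‖w θ‖ₑ ^ p ∂haarTorus with hY
  have hYtop : Y ≠ ∞ := by
    have : MemLp w (ENNReal.ofReal p) haarTorus :=
      MemLp.of_bound hwm.aestronglyMeasurable N (.of_forall hwN)
    have h1 := lintegral_rpow_enorm_lt_top_of_eLpNorm_lt_top hP0 ENNReal.ofReal_ne_top this.2
    rw [ENNReal.toReal_ofReal hp0.le] at h1
    exact h1.ne
  have hX : eLpNorm w (ENNReal.ofReal p) haarTorus = Y ^ p⁻¹ := by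
    rw [eLpNorm_eq_lintegral_rpow_enorm_toReal hP0 ENNReal.ofReal_ne_top,
      ENNReal.toReal_ofReal hp0.le, one_div]
  have hgq : eLpNorm g (ENNReal.ofReal q) haarTorus = Y ^ q⁻¹ := by
    rw [eLpNorm_eq_lintegral_rpow_enorm_toReal hQ0 ENNReal.ofReal_ne_top,
      ENNReal.toReal_ofReal hq0.le, one_div]
    congr 1
    refine lintegral_congr fun θ => ?_
    rw [← ofReal_norm, hgn, ← ofReal_norm, ENNReal.ofReal_rpow_of_nonneg (by positivity) hq0.le,
      ENNReal.ofReal_rpow_of_nonneg (by positivity) hp0.le, ← Real.rpow_mul (norm_nonneg _),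
      hpq.sub_one_mul_conj]
  set G : CircleL2 := hgmem.toLp g
  have hGv : inner ℂ G v = ((∫ θ, ‖w θ‖ ^ p ∂haarTorus : ℝ) : ℂ) := by
    rw [L2.inner_def, ← integral_complex_ofReal]
    refine integral_congr_ae ?_
    filter_upwards [hgmem.coeFn_toLp] with θ hθ
    rw [hθ, RCLike.inner_apply, hg]
    simp only [map_mul, Complex.conj_ofReal]
    by_cases h : ‖v θ‖ ≤ N
    · have h1 : w θ = v θ := Set.indicator_of_mem (show θ ∈ {θ | ‖v θ‖ ≤ (N : ℝ)} from h) v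
      rw [h1, mul_left_comm, Complex.mul_conj, ← Complex.ofReal_mul, Complex.normSq_eq_norm_sq]
      congr 1
      rcases (norm_nonneg (v θ)).eq_or_lt with h2 | h2
      · rw [← h2, Real.zero_rpow hp0.ne']
        simp
      · rw [← Real.rpow_natCast, ← Real.rpow_add h2]
        congr 1
        push_cast
        ring
    · have h1 : w θ = 0 := Set.indicator_of_notMem (show θ ∉ {θ | ‖v θ‖ ≤ (N : ℝ)} from h) v
      simp [h1, Real.zero_rpow hp0.ne']
  have hYG : Y = ‖inner ℂ G v‖ₑ := by
    have hnn : 0 ≤ ∫ θ, ‖w θ‖ ^ p ∂haarTorus := integral_nonneg fun _ => by positivity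
    rw [hGv, ← ofReal_norm, Complex.norm_real, Real.norm_of_nonneg hnn,
      ofReal_integral_eq_lintegral_ofReal]
    · refine lintegral_congr fun θ => ?_
      rw [← ofReal_norm, ENNReal.ofReal_rpow_of_nonneg (norm_nonneg _) hp0.le]
    · exact Integrable.of_bound (hwm.norm.pow_const p).aestronglyMeasurable ((N : ℝ) ^ p)
        (.of_forall fun θ => by
          rw [Real.norm_of_nonneg (by positivity)]
          exact Real.rpow_le_rpow (norm_nonneg _) (hwN θ) hp0.le)
    · exact .of_forall fun θ => by positivity
  have hswap : inner ℂ G v = inner ℂ (rieszProjection G) u := by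
    rw [hv, rieszProjection, Submodule.inner_starProjection_left_eq_right]
  have hle : Y ≤ C * eLpNorm u (ENNReal.ofReal p) haarTorus * Y ^ q⁻¹ := by
    calc Y = ‖inner ℂ (rieszProjection G) u‖ₑ := by rw [hYG, hswap]
      _ ≤ ∫⁻ θ, ‖inner ℂ (rieszProjection G θ) (u θ)‖ₑ ∂haarTorus := by
          rw [L2.inner_def]
          exact enorm_integral_le_lintegral_enorm _
      _ = ∫⁻ θ, ((fun θ => ‖rieszProjection G θ‖ₑ) * fun θ => ‖u θ‖ₑ) θ ∂haarTorus := by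
          refine lintegral_congr fun θ => ?_
          rw [RCLike.inner_apply, enorm_mul, mul_comm, Pi.mul_apply]
          congr 1
          rw [← ofReal_norm, ← ofReal_norm, RCLike.norm_conj]
      _ ≤ eLpNorm (rieszProjection G) (ENNReal.ofReal q) haarTorus
            * eLpNorm u (ENNReal.ofReal p) haarTorus := by
          rw [eLpNorm_eq_lintegral_rpow_enorm_toReal hP0 ENNReal.ofReal_ne_top,
            eLpNorm_eq_lintegral_rpow_enorm_toReal hQ0 ENNReal.ofReal_ne_top,
            ENNReal.toReal_ofReal hp0.le, ENNReal.toReal_ofReal hq0.le]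
          exact ENNReal.lintegral_mul_le_Lp_mul_Lq _ hpq.symm
            (Lp.aestronglyMeasurable _).enorm (Lp.aestronglyMeasurable _).enorm
      _ ≤ (C * eLpNorm G (ENNReal.ofReal q) haarTorus)
            * eLpNorm u (ENNReal.ofReal p) haarTorus := by
          gcongr
          exact hC G
      _ = _ := by
          rw [eLpNorm_congr_ae hgmem.coeFn_toLp, hgq]
          ring
  rw [hX]
  rcases eq_or_ne Y 0 with h0 | h0
  · rw [h0, ENNReal.zero_rpow_of_pos (by positivity)]
    exact zero_le
  -- Dividing by Y^{1/q} is legitimate because `Y` is neither zero nor infinite.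
  · have h1 : Y ^ p⁻¹ * Y ^ q⁻¹ = Y := by
      rw [← ENNReal.rpow_add _ _ h0 hYtop, hpq.inv_add_inv_eq_one, ENNReal.rpow_one]
    have h2 : Y ^ q⁻¹ ≠ 0 := by simp [h0, hYtop]
    have h3 : Y ^ q⁻¹ ≠ ∞ := ENNReal.rpow_ne_top_of_nonneg (by positivity) hYtop
    refine (ENNReal.mul_le_mul_iff_left h2 h3).1 ?_
    rwa [h1]

/-- The theorem of M. Riesz: the Riesz projection is bounded for the norm of `Lᵖ`. -/
theorem exists_eLpNorm_rieszProjection_le {p : ℝ} (hp1 : 1 < p) :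
    ∃ C : ℝ≥0∞, C ≠ ∞ ∧ ∀ u : CircleL2,
      eLpNorm (rieszProjection u) (ENNReal.ofReal p) haarTorus ≤
        C * eLpNorm u (ENNReal.ofReal p) haarTorus := by
  rcases le_total p 2 with hp2 | hp2
  · exact exists_eLpNorm_rieszProjection_le_of_le_two hp1 hp2
  have hpq := Real.HolderConjugate.conjExponent hp1
  have hq2 : p.conjExponent ≤ 2 := by
    rw [Real.conjExponent, div_le_iff₀ (by linarith)]
    linarith
  obtain ⟨C, hC, h⟩ := exists_eLpNorm_rieszProjection_le_of_le_two hpq.symm.lt hq2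
  refine ⟨C, hC, fun u => ?_⟩
  set v := rieszProjection u with hv
  have hvm : StronglyMeasurable v := Lp.stronglyMeasurable v
  -- Fatou's lemma removes the truncation, the bound being uniform in its height.
  refine (Lp.eLpNorm_lim_le_liminf_eLpNorm
    (f := fun N : ℕ => {θ | ‖v θ‖ ≤ N}.indicator v) (fun N =>
      (hvm.indicator (measurableSet_le hvm.measurable.norm
        measurable_const)).aestronglyMeasurable) v (.of_forall fun θ => ?_)).trans ?_
  · refine tendsto_const_nhds.congr' ?_
    obtain ⟨M, hM⟩ := exists_nat_ge ‖v θ‖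
    filter_upwards [eventually_ge_atTop M] with N hN
    exact (Set.indicator_of_mem (show θ ∈ {θ | ‖v θ‖ ≤ (N : ℝ)} from
      hM.trans (by exact_mod_cast hN)) v).symm
  · exact (liminf_le_liminf (.of_forall fun N =>
      eLpNorm_indicator_rieszProjection_le hpq hp2 h u N)).trans_eq (liminf_const _)

/-! ### The outer function and the weighted norms. -/

theorem volume_eq_smul_haarTorus :
    (volume : Measure Torus) = ENNReal.ofReal (2 * Real.pi) • haarTorus :=
  AddCircle.volume_eq_smul_haarAddCircle

theorem ae_haarTorus_eq : ae haarTorus = ae (volume : Measure Torus) := by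
  rw [volume_eq_smul_haarTorus, Measure.ae_ennreal_smul_measure_eq]
  simpa using Real.pi_pos

theorem ae_circleMeasure_eq (β : ℝ) : ae (circleMeasure β) = ae (volume : Measure Torus) :=
  le_antisymm (withDensity_absolutelyContinuous _ _).ae_le (volume_ac_circleMeasure β).ae_le

theorem circleMeasure_ac_haarTorus (β : ℝ) : circleMeasure β ≪ haarTorus :=
  Measure.ae_le_iff_absolutelyContinuous.1 (by rw [ae_circleMeasure_eq, ae_haarTorus_eq])

theorem haarTorus_ac_circleMeasure (β : ℝ) : haarTorus ≪ circleMeasure β :=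
  Measure.ae_le_iff_absolutelyContinuous.1 (by rw [ae_circleMeasure_eq, ae_haarTorus_eq])

/-- The outer function `(1 - z) ^ α`, whose modulus is `|z - 1| ^ α`. -/
def outer (α : ℝ) (z : ℂ) : ℂ := (1 - z) ^ (α : ℂ)

theorem norm_outer (α : ℝ) (z : ℂ) : ‖outer α z‖ = ‖z - 1‖ ^ α := by
  rw [outer, Complex.norm_cpow_real, norm_sub_rev]

theorem outer_ne_zero (α : ℝ) {z : ℂ} (hz : z ≠ 1) : outer α z ≠ 0 := by
  rw [← norm_pos_iff, norm_outer]
  exact Real.rpow_pos_of_pos (norm_pos_iff.2 (sub_ne_zero.2 hz)) α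

theorem enorm_outer_rpow (α : ℝ) {s : ℝ} (hs : 0 ≤ s) (z : ℂ) :
    ‖outer α z‖ₑ ^ s = weight (α * s) z := by
  rw [weight, ← ofReal_norm, norm_outer, ENNReal.ofReal_rpow_of_nonneg (by positivity) hs,
    ← Real.rpow_mul (norm_nonneg _)]

theorem enorm_outer_sq (α : ℝ) (z : ℂ) : ‖outer α z‖ₑ ^ 2 = weight (2 * α) z := by
  rw [mul_comm, ← enorm_outer_rpow α zero_le_two]
  norm_cast

theorem one_sub_mem_slitPlane {z : ℂ} (hz : ‖z‖ ≤ 1) (hz1 : z ≠ 1) :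
    1 - z ∈ Complex.slitPlane := by
  refine Or.inl ?_
  rw [Complex.sub_re, Complex.one_re, sub_pos]
  refine lt_of_le_of_ne ((Complex.re_le_norm z).trans hz) fun h => hz1 ?_
  have h1 : ‖z‖ ^ 2 ≤ 1 := pow_le_one₀ (norm_nonneg z) hz
  rw [Complex.sq_norm, Complex.normSq_apply, h] at h1
  exact Complex.ext h (by simpa using (by nlinarith [mul_self_nonneg z.im] : z.im * z.im = 0))

theorem ne_one_of_mem_ball {z : ℂ} (hz : z ∈ Metric.ball (0 : ℂ) 1) : z ≠ 1 := by
  rintro rfl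
  simp at hz

theorem differentiableOn_outer (α : ℝ) : DifferentiableOn ℂ (outer α) (Metric.ball 0 1) :=
  DifferentiableOn.cpow_const (by fun_prop) fun z hz =>
    one_sub_mem_slitPlane (mem_ball_zero_iff.1 hz).le (ne_one_of_mem_ball hz)

theorem continuousAt_outer (α : ℝ) {z : ℂ} (hz : ‖z‖ ≤ 1) (hz1 : z ≠ 1) :
    ContinuousAt (outer α) z :=
  ContinuousAt.cpow (by fun_prop) continuousAt_const (one_sub_mem_slitPlane hz hz1)

theorem ae_expI_ne_one : ∀ᵐ θ : Torus, expI θ ≠ 1 := by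
  have h : ∀ᵐ θ : Torus, θ ≠ 0 := by
    have h0 := AddCircle.volume_closedBall (2 * Real.pi) (x := 0) 0
    simpa [ae_iff, Real.two_pi_pos.le] using h0
  filter_upwards [h] with θ hθ h0
  exact hθ <| AddCircle.injective_toCircle Real.two_pi_pos.ne' <| Circle.ext <| by
    simpa [expI] using h0

theorem ae_outer_ne_zero (α : ℝ) : ∀ᵐ θ ∂haarTorus, outer α (expI θ) ≠ 0 := by
  rw [ae_haarTorus_eq]
  filter_upwards [ae_expI_ne_one] with θ hθ using outer_ne_zero α hθ

theorem measurable_outer_expI (α : ℝ) : Measurable fun θ : Torus => outer α (expI θ) := by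
  unfold outer
  exact (measurable_const.sub continuous_expI.measurable).pow_const _

theorem tendsto_radial {g : ℂ → ℂ} {θ : Torus} (hg : ContinuousAt g (expI θ)) :
    Tendsto (fun r : ℝ => g (r * expI θ)) (𝓝[<] 1) (𝓝 (g (expI θ))) := by
  refine hg.tendsto.comp (Tendsto.mono_left ?_ nhdsWithin_le_nhds)
  have : Continuous fun r : ℝ => (r : ℂ) * expI θ := by fun_prop
  simpa using this.tendsto 1

/-- The ratio between norms for Lebesgue measure and for normalised Lebesgue measure. -/
def massFactor (p : ℝ≥0∞) : ℝ≥0∞ := ENNReal.ofReal (2 * Real.pi) ^ (1 / p).toReal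

theorem massFactor_ne_zero (p : ℝ≥0∞) : massFactor p ≠ 0 := by
  have : ENNReal.ofReal (2 * Real.pi) ≠ 0 := by simpa using Real.pi_pos
  exact (ENNReal.rpow_pos (pos_iff_ne_zero.2 this) ENNReal.ofReal_ne_top).ne'

theorem massFactor_ne_top (p : ℝ≥0∞) : massFactor p ≠ ∞ :=
  ENNReal.rpow_ne_top_of_nonneg (by positivity) ENNReal.ofReal_ne_top

/-- Since |h|^p = |z - 1|^{αp}, a single multiplier h removes the weight for every finite exponent.
This is why the weight must vary with p. -/
theorem eLpNorm_circleMeasure (α : ℝ) {p : ℝ≥0∞} (hp0 : p ≠ 0) (hp : p ≠ ∞) (f : Torus → ℂ) :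
    eLpNorm f p (circleMeasure (α * p.toReal)) =
      massFactor p * eLpNorm (fun θ => outer α (expI θ) * f θ) p haarTorus := by
  have hvol : eLpNorm f p (circleMeasure (α * p.toReal)) =
      eLpNorm (fun θ => outer α (expI θ) * f θ) p volume := by
    rw [eLpNorm_eq_lintegral_rpow_enorm_toReal hp0 hp,
      eLpNorm_eq_lintegral_rpow_enorm_toReal hp0 hp, circleMeasure,
      lintegral_withDensity_eq_lintegral_mul_non_measurable _
        (f := fun θ => weight (α * p.toReal) (expI θ)) ((measurable_weight _).comp continuous_expI.measurable)
        (.of_forall fun θ => ENNReal.ofReal_lt_top)]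
    congr 1
    refine lintegral_congr fun θ => ?_
    rw [Pi.mul_apply, enorm_mul, ENNReal.mul_rpow_of_nonneg _ _ ENNReal.toReal_nonneg,
      enorm_outer_rpow α ENNReal.toReal_nonneg]
  rw [hvol, volume_eq_smul_haarTorus, eLpNorm_smul_measure_of_ne_top hp, smul_eq_mul, massFactor]

theorem aestronglyMeasurable_circleMeasure_iff (α β : ℝ) {f : Torus → ℂ} :
    AEStronglyMeasurable f (circleMeasure β) ↔
      AEStronglyMeasurable (fun θ => outer α (expI θ) * f θ) haarTorus := by
  have hm := measurable_outer_expI α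
  constructor
  · intro hf
    exact hm.aestronglyMeasurable.mul (hf.mono_ac (haarTorus_ac_circleMeasure β))
  · intro hf
    refine ((hm.inv.aestronglyMeasurable.mul hf).congr ?_).mono_ac (circleMeasure_ac_haarTorus β)
    filter_upwards [ae_outer_ne_zero α] with θ hθ
    exact inv_mul_cancel_left₀ hθ _

theorem memLp_circleMeasure_iff (α : ℝ) {p : ℝ≥0∞} (hp0 : p ≠ 0) (hp : p ≠ ∞) {f : Torus → ℂ} :
    MemLp f p (circleMeasure (α * p.toReal)) ↔
      MemLp (fun θ => outer α (expI θ) * f θ) p haarTorus := by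
  rw [MemLp, MemLp, ← aestronglyMeasurable_circleMeasure_iff, eLpNorm_circleMeasure α hp0 hp,
    ENNReal.mul_lt_top_iff]
  have := massFactor_ne_zero p
  have := massFactor_ne_top p
  constructor
  · rintro ⟨h1, h2 | h2 | h2⟩
    · exact ⟨h1, h2.2⟩
    · contradiction
    · simp [h1, h2]
  · rintro ⟨h1, h2⟩
    exact ⟨h1, Or.inl ⟨by rwa [lt_top_iff_ne_top], h2⟩⟩

theorem eLpNorm_circleMeasure_two (α : ℝ) (f : Torus → ℂ) :
    eLpNorm f 2 (circleMeasure (2 * α)) =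
      massFactor 2 * eLpNorm (fun θ => outer α (expI θ) * f θ) 2 haarTorus := by
  rw [← eLpNorm_circleMeasure α two_ne_zero (by simp), ENNReal.toReal_ofNat, mul_comm α]

theorem memLp_circleMeasure_two_iff (α : ℝ) {f : Torus → ℂ} :
    MemLp f 2 (circleMeasure (2 * α)) ↔ MemLp (fun θ => outer α (expI θ) * f θ) 2 haarTorus := by
  rw [← memLp_circleMeasure_iff α two_ne_zero (by simp), ENNReal.toReal_ofNat, mul_comm α]

/-! ### Conjugating the Szegő projection to the Riesz projection. -/

/-- Division by the outer function, normalised to be an isometry. -/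
def divOuter (α : ℝ) (a : Torus → ℂ) (θ : Torus) : ℂ :=
  ((massFactor 2).toReal : ℂ)⁻¹ * ((outer α (expI θ))⁻¹ * a θ)

theorem massFactor_toReal_ne_zero : ((massFactor 2).toReal : ℂ) ≠ 0 := by
  simp [ENNReal.toReal_eq_zero_iff, massFactor_ne_zero, massFactor_ne_top]

theorem outer_mul_divOuter (α : ℝ) (a : Torus → ℂ) :
    (fun θ => outer α (expI θ) * divOuter α a θ) =ᵐ[haarTorus]
      ((massFactor 2).toReal : ℂ)⁻¹ • a := by
  filter_upwards [ae_outer_ne_zero α] with θ hθ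
  rw [divOuter, mul_left_comm, mul_inv_cancel_left₀ hθ, Pi.smul_apply, smul_eq_mul]

theorem memLp_divOuter (α : ℝ) (a : CircleL2) :
    MemLp (divOuter α a) 2 (circleMeasure (2 * α)) :=
  (memLp_circleMeasure_two_iff α).2
    (((Lp.memLp a).const_smul _).ae_eq (outer_mul_divOuter α a).symm)

theorem divOuter_congr (α : ℝ) {a b : Torus → ℂ} (h : a =ᵐ[haarTorus] b) :
    divOuter α a =ᵐ[circleMeasure (2 * α)] divOuter α b := by
  filter_upwards [(circleMeasure_ac_haarTorus (2 * α)).ae_le h] with θ hθ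
  rw [divOuter, divOuter, hθ]

/-- Division by the outer function, as an isometry from `L²` to the weighted space. -/
def divOuterIsometry (α : ℝ) : CircleL2 →ₗᵢ[ℂ] Lp ℂ 2 (circleMeasure (2 * α)) where
  toFun a := (memLp_divOuter α a).toLp _
  map_add' a b := Lp.ext <| by
    filter_upwards [(memLp_divOuter α (a + b)).coeFn_toLp, (memLp_divOuter α a).coeFn_toLp,
      (memLp_divOuter α b).coeFn_toLp, divOuter_congr α (Lp.coeFn_add a b),
      Lp.coeFn_add ((memLp_divOuter α a).toLp _) ((memLp_divOuter α b).toLp _)]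
      with θ h1 h2 h3 h4 h5
    rw [h1, h4, h5, Pi.add_apply, h2, h3]
    simp only [divOuter, Pi.add_apply]
    ring
  map_smul' c a := Lp.ext <| by
    filter_upwards [(memLp_divOuter α (c • a)).coeFn_toLp, (memLp_divOuter α a).coeFn_toLp,
      divOuter_congr α (Lp.coeFn_smul c a), Lp.coeFn_smul c ((memLp_divOuter α a).toLp _)]
      with θ h1 h2 h3 h4
    rw [h1, h3, RingHom.id_apply, h4, Pi.smul_apply, h2]
    simp only [divOuter, Pi.smul_apply, smul_eq_mul]
    ring
  norm_map' a := by
    change ‖(memLp_divOuter α a).toLp _‖ = ‖a‖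
    rw [Lp.norm_toLp, eLpNorm_circleMeasure_two, eLpNorm_congr_ae (outer_mul_divOuter α a),
      eLpNorm_const_smul, Lp.norm_def, ← mul_assoc]
    rw [ENNReal.toReal_mul, ENNReal.toReal_mul, toReal_enorm, norm_inv, Complex.norm_real,
      Real.norm_of_nonneg ENNReal.toReal_nonneg, mul_inv_cancel₀, one_mul]
    exact_mod_cast massFactor_toReal_ne_zero

theorem coeFn_divOuterIsometry (α : ℝ) (a : CircleL2) :
    divOuterIsometry α a =ᵐ[circleMeasure (2 * α)] divOuter α a :=
  (memLp_divOuter α a).coeFn_toLp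

theorem outer_mul_divOuterIsometry (α : ℝ) (a : CircleL2) :
    (fun θ => outer α (expI θ) * divOuterIsometry α a θ) =ᵐ[haarTorus]
      ((massFactor 2).toReal : ℂ)⁻¹ • (a : Torus → ℂ) := by
  refine EventuallyEq.trans ?_ (outer_mul_divOuter α a)
  filter_upwards [(haarTorus_ac_circleMeasure _).ae_le (coeFn_divOuterIsometry α a)] with θ hθ
  rw [hθ]

theorem divOuterIsometry_smul_eq (α : ℝ) {a : CircleL2} {F : Lp ℂ 2 (circleMeasure (2 * α))}
    (h : a =ᵐ[haarTorus] fun θ => outer α (expI θ) * F θ) :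
    divOuterIsometry α (((massFactor 2).toReal : ℂ) • a) = F := Lp.ext <| by
  rw [map_smul]
  filter_upwards [Lp.coeFn_smul ((massFactor 2).toReal : ℂ) (divOuterIsometry α a),
    coeFn_divOuterIsometry α a, (circleMeasure_ac_haarTorus (2 * α)).ae_le h,
    (circleMeasure_ac_haarTorus (2 * α)).ae_le (ae_outer_ne_zero α)] with θ h1 h2 h3 h4
  rw [h1, Pi.smul_apply, h2, divOuter, h3, inv_mul_cancel_left₀ h4, smul_eq_mul,
    mul_inv_cancel_left₀ massFactor_toReal_ne_zero]

/-- The weight cancels |h|⁻² inside the disc as well, leaving |c|²|z|^{2n} ≤ |c|². -/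
theorem memHardyTwo_div_outer (α : ℝ) (c : ℂ) (n : ℕ) :
    MemHardyTwo (2 * α) fun z => c * ((outer α z)⁻¹ * z ^ n) := by
  refine ⟨((differentiableOn_outer α).inv fun z hz =>
    outer_ne_zero α (ne_one_of_mem_ball hz)).mul (by fun_prop) |>.const_mul c, ?_⟩
  refine lt_of_le_of_lt (iSup₂_le fun r hr => ?_)
    (ENNReal.mul_lt_top (a := ‖c‖ₑ ^ 2) (b := (volume : Measure Torus) Set.univ) (by simp)
      (measure_lt_top _ _))
  rw [← lintegral_const]
  refine lintegral_mono fun θ => ?_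
  have hz : ‖(r : ℂ) * expI θ‖ < 1 := by simpa [norm_expI, abs_of_nonneg hr.1] using hr.2
  have h0 : outer α (r * expI θ) ≠ 0 :=
    outer_ne_zero α (ne_one_of_mem_ball (mem_ball_zero_iff.2 hz))
  rw [← enorm_outer_sq, ← mul_pow, ← enorm_mul]
  refine pow_le_pow_left' ?_ 2
  rw [mul_assoc, mul_right_comm, inv_mul_cancel₀ h0, one_mul, enorm_mul]
  refine mul_le_of_le_one_right' ?_
  rw [← ofReal_norm, norm_pow]
  exact ENNReal.ofReal_le_one.2 (pow_le_one₀ (norm_nonneg _) hz.le)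

theorem divOuterIsometry_circleBasis_mem (α : ℝ) (n : ℕ) :
    divOuterIsometry α (circleBasis (n : ℤ)) ∈ hardyTwo (2 * α) := by
  refine ⟨_, memHardyTwo_div_outer α ((massFactor 2).toReal : ℂ)⁻¹ n, ?_⟩
  have h1 : (circleBasis (n : ℤ) : Torus → ℂ) =ᵐ[haarTorus] fourier (n : ℤ) := by
    rw [coe_fourierBasis]
    exact coeFn_fourierLp 2 _
  have h2 := (coeFn_divOuterIsometry α (circleBasis (n : ℤ))).trans (divOuter_congr α h1)
  filter_upwards [(volume_ac_circleMeasure _).ae_le h2, ae_expI_ne_one] with θ h3 h4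
  rw [h3, divOuter, fourier_natCast_eq_expI_pow]
  refine tendsto_radial (g := fun z => ((massFactor 2).toReal : ℂ)⁻¹ * ((outer α z)⁻¹ * z ^ n)) ?_
  exact continuousAt_const.mul (((continuousAt_outer α (norm_expI θ).le h4).inv₀
    (outer_ne_zero α h4)).mul (by fun_prop))

theorem exists_mem_hardyCircle_of_mem_hardyTwo {α : ℝ} {F : Lp ℂ 2 (circleMeasure (2 * α))}
    (hF : F ∈ hardyTwo (2 * α)) :
    ∃ a ∈ hardyCircle, a =ᵐ[haarTorus] fun θ => outer α (expI θ) * F θ := by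
  obtain ⟨f, hf, hlim⟩ := hF
  set M := ⨆ r ∈ Set.Ico (0 : ℝ) 1,
    ∫⁻ θ : Torus, ‖f (r * expI θ)‖ₑ ^ 2 * weight (2 * α) (r * expI θ)
  -- The constant is the weighted Hardy bound, rescaled by 1/(2π) for the normalised measure, then
  -- square-rooted.
  refine exists_mem_hardyCircle_of_radial (g := fun z => outer α z * f z)
    ((differentiableOn_outer α).mul hf.1)
    (C := ((ENNReal.ofReal (2 * Real.pi))⁻¹ * M) ^ (1 / (2 : ℝ))) ?_ ?_ ?_
  · refine ENNReal.rpow_ne_top_of_nonneg (by norm_num) (ENNReal.mul_ne_top ?_ hf.2.ne)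
    simpa using Real.pi_pos
  · intro r hr
    rw [eLpNorm_eq_lintegral_rpow_enorm_toReal two_ne_zero (by simp), ENNReal.toReal_ofNat]
    refine ENNReal.rpow_le_rpow ?_ (by norm_num)
    have h2 : ENNReal.ofReal (2 * Real.pi) ≠ 0 := by simpa using Real.pi_pos
    rw [← ENNReal.div_eq_inv_mul, ENNReal.le_div_iff_mul_le (.inl h2) (.inl ENNReal.ofReal_ne_top), mul_comm,
      ← smul_eq_mul, ← lintegral_smul_measure, ← volume_eq_smul_haarTorus]
    refine le_trans (le_of_eq (lintegral_congr fun θ => ?_))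
      (le_iSup₂ (f := fun (r : ℝ) (_ : r ∈ Set.Ico (0 : ℝ) 1) => ∫⁻ θ : Torus,
        ‖f (r * expI θ)‖ₑ ^ 2 * weight (2 * α) (r * expI θ)) r hr)
    rw [← enorm_outer_sq, ← mul_pow, mul_comm, enorm_mul]
    norm_cast
  · rw [ae_haarTorus_eq]
    filter_upwards [hlim, ae_expI_ne_one] with θ h1 h2
    exact (tendsto_radial (continuousAt_outer α (norm_expI θ).le h2)).mul h1

/-- One inclusion multiplies by h and uses that an isometry has closed image; the other divides each
z^n by h and passes to the closed span. -/
theorem topologicalClosure_hardyTwo (α : ℝ) :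
    (hardyTwo (2 * α)).topologicalClosure =
      hardyCircle.map (divOuterIsometry α).toLinearMap := by
  refine le_antisymm (Submodule.topologicalClosure_minimal _ ?_ ?_) ?_
  · intro F hF
    obtain ⟨a, ha, h⟩ := exists_mem_hardyCircle_of_mem_hardyTwo hF
    exact ⟨_, Submodule.smul_mem _ _ ha, divOuterIsometry_smul_eq α h⟩
  · exact (divOuterIsometry α).isometry.isClosedEmbedding.isClosedMap _ isClosed_hardyCircle
  · rintro _ ⟨a, ha, rfl⟩
    refine map_mem_closure (divOuterIsometry α).continuous (s := _) ha fun b hb => ?_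
    induction hb using Submodule.span_induction with
    | mem x hx =>
      obtain ⟨n, rfl⟩ := hx
      exact divOuterIsometry_circleBasis_mem α n
    | zero =>
      rw [map_zero]
      exact zero_mem _
    | add x y _ _ hx hy =>
      rw [map_add]
      exact add_mem hx hy
    | smul c x _ hx =>
      rw [map_smul]
      exact Submodule.smul_mem _ c hx

/-- A linear isometry intertwines the projection onto a subspace with the projection onto its image.
-/
theorem szegoProjection_divOuterIsometry (α : ℝ) (a : CircleL2) :
    szegoProjection (2 * α) (divOuterIsometry α a) = divOuterIsometry α (rieszProjection a) := by
  have hproj : (hardyCircle.map (divOuterIsometry α).toLinearMap).HasOrthogonalProjection := by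
    rw [← topologicalClosure_hardyTwo]
    infer_instance
  have h := LinearIsometry.map_starProjection (divOuterIsometry α) hardyCircle a
  rw [rieszProjection, h, szegoProjection]
  congr 2
  exact topologicalClosure_hardyTwo α

/-- The weighted Szegő projection is conjugate to the Riesz projection. -/
theorem exists_outer_mul_szegoProjection_eq (α : ℝ) {f : Torus → ℂ}
    (hf : MemLp f 2 (circleMeasure (2 * α))) :
    ∃ a : CircleL2, a =ᵐ[haarTorus] (fun θ => outer α (expI θ) * f θ) ∧
      (fun θ => outer α (expI θ) * szegoProjection (2 * α) (hf.toLp f) θ) =ᵐ[haarTorus]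
        rieszProjection a := by
  have hm := (memLp_circleMeasure_two_iff α).1 hf
  set a : CircleL2 := hm.toLp _
  have ha : a =ᵐ[haarTorus] fun θ => outer α (expI θ) * hf.toLp f θ := by
    filter_upwards [hm.coeFn_toLp, (haarTorus_ac_circleMeasure _).ae_le hf.coeFn_toLp]
      with θ h1 h2
    rw [h1, h2]
  refine ⟨a, hm.coeFn_toLp, ?_⟩
  rw [← divOuterIsometry_smul_eq α ha, szegoProjection_divOuterIsometry]
  refine (outer_mul_divOuterIsometry α _).trans ?_
  rw [map_smul]
  filter_upwards [Lp.coeFn_smul ((massFactor 2).toReal : ℂ) (rieszProjection a)] with θ hθ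
  rw [Pi.smul_apply, hθ, Pi.smul_apply, smul_smul, inv_mul_cancel₀ massFactor_toReal_ne_zero,
    one_smul]

theorem exists_eLpNorm_szegoProjection_le (α : ℝ) {p : ℝ≥0∞} (hp : 1 < p) (hp' : p < ∞) :
    ∃ C : ℝ≥0∞, C ≠ ∞ ∧ ∀ (f : Torus → ℂ) (hf : MemLp f 2 (circleMeasure (2 * α))),
      eLpNorm (szegoProjection (2 * α) (hf.toLp f)) p (circleMeasure (α * p.toReal)) ≤
        C * eLpNorm f p (circleMeasure (α * p.toReal)) := by
  have hp0 : p ≠ 0 := (zero_lt_one.trans hp).ne'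
  obtain ⟨C, hC, h⟩ := exists_eLpNorm_rieszProjection_le (p := p.toReal)
    ((ENNReal.toReal_lt_toReal (by simp) hp'.ne).2 hp)
  rw [ENNReal.ofReal_toReal hp'.ne] at h
  refine ⟨C, hC, fun f hf => ?_⟩
  obtain ⟨a, ha, hS⟩ := exists_outer_mul_szegoProjection_eq α hf
  rw [eLpNorm_circleMeasure α hp0 hp'.ne, eLpNorm_circleMeasure α hp0 hp'.ne,
    eLpNorm_congr_ae hS, ← eLpNorm_congr_ae ha, mul_left_comm]
  gcongr
  exact h a

/-! ### Density and extension to the weighted space. -/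

theorem isFiniteMeasure_circleMeasure {β : ℝ} (hβ : 0 ≤ β) : IsFiniteMeasure (circleMeasure β) := by
  refine isFiniteMeasure_withDensity (ne_top_of_le_ne_top ?_ (lintegral_mono (fun θ =>
    (ENNReal.ofReal_le_ofReal (Real.rpow_le_rpow (norm_nonneg _) (?_ : _ ≤ (2 : ℝ)) hβ)))))
  · rw [lintegral_const]
    exact ENNReal.mul_ne_top ENNReal.ofReal_ne_top (measure_ne_top _ _)
  · calc ‖expI θ - 1‖ ≤ ‖expI θ‖ + ‖(1 : ℂ)‖ := norm_sub_le _ _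
      _ = 2 := by rw [norm_expI, norm_one]; norm_num

/-- The elements of an `Lᵖ` space that are square integrable for another measure. -/
def squareIntegrable (p : ℝ≥0∞) {μ ν : Measure Torus} (h : ν ≪ μ) : Submodule ℂ (Lp ℂ p μ) where
  carrier := {F | MemLp F 2 ν}
  zero_mem' := (MemLp.zero' (ε := ℂ)).ae_eq (h.ae_eq (Lp.coeFn_zero ℂ p μ)).symm
  add_mem' {F G} hF hG := (hF.add hG).ae_eq (h.ae_eq (Lp.coeFn_add F G)).symm
  smul_mem' c F hF := (hF.const_smul c).ae_eq (h.ae_eq (Lp.coeFn_smul c F)).symm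

/-- Simple functions are dense in L^p and, being bounded, square integrable for any finite measure.
-/
theorem dense_squareIntegrable {p : ℝ≥0∞} [Fact (1 ≤ p)] (hp : p ≠ ∞) {μ ν : Measure Torus}
    [IsFiniteMeasure ν] (h : ν ≪ μ) : DenseRange (squareIntegrable p h).subtype := by
  have hd : Dense (Lp.simpleFunc ℂ p μ : Set (Lp ℂ p μ)) := by
    have := Lp.simpleFunc.denseRange (E := ℂ) (μ := μ) hp
    simpa [DenseRange] using this
  refine hd.mono ?_
  intro F hF
  have h1 := Lp.simpleFunc.toSimpleFunc_eq_toFun (⟨F, hF⟩ : Lp.simpleFunc ℂ p μ)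
  exact ⟨⟨F, ((Lp.simpleFunc.toSimpleFunc
    (⟨F, hF⟩ : Lp.simpleFunc ℂ p μ)).memLp_of_isFiniteMeasure 2 ν).ae_eq (h.ae_le h1)⟩, rfl⟩

end

theorem proposition3p2 (α : ℝ) (hα : 0 ≤ α) (p : ℝ≥0∞) [Fact (1 ≤ p)] (hp : 1 < p) (hp' : p < ∞) :
    ∃! T : Lp ℂ p (circleMeasure (α * p.toReal)) →L[ℂ] Lp ℂ p (circleMeasure (α * p.toReal)),
      ∀ (f : Torus → ℂ) (hf₂ : MemLp f 2 (circleMeasure (2 * α)))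
        (hfp : MemLp f p (circleMeasure (α * p.toReal))),
        (T (hfp.toLp f) : Torus → ℂ) =ᵐ[volume] szegoProjection (2 * α) (hf₂.toLp f) := by
  set μ := circleMeasure (α * p.toReal)
  have hνμ : circleMeasure (2 * α) ≪ μ :=
    (withDensity_absolutelyContinuous _ _).trans (volume_ac_circleMeasure _)
  have hμν : μ ≪ circleMeasure (2 * α) :=
    (withDensity_absolutelyContinuous _ _).trans (volume_ac_circleMeasure _)
  -- Here α ≥ 0 enters: the weight is then bounded on the circle.
  have : IsFiniteMeasure (circleMeasure (2 * α)) := isFiniteMeasure_circleMeasure (by positivity)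
  obtain ⟨C, hC, hbound⟩ := exists_eLpNorm_szegoProjection_le α hp hp'
  set E := squareIntegrable p hνμ
  have hdense : DenseRange E.subtype := dense_squareIntegrable hp'.ne hνμ
  have hE : ∀ F : E, MemLp (F : Lp ℂ p μ) 2 (circleMeasure (2 * α)) := fun F => F.2
  let S : E → Lp ℂ 2 (circleMeasure (2 * α)) := fun F => szegoProjection (2 * α) ((hE F).toLp _)
  have hS : ∀ F : E, MemLp (S F) p μ := fun F =>
    ⟨(Lp.aestronglyMeasurable _).mono_ac hμν,
      (hbound _ (hE F)).trans_lt (ENNReal.mul_lt_top hC.lt_top (Lp.eLpNorm_lt_top _))⟩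
  have hSadd : ∀ F G : E, S (F + G) = S F + S G := fun F G => by
    simp only [S]
    rw [← map_add, ← MemLp.toLp_add]
    exact congrArg (szegoProjection (2 * α)) (MemLp.toLp_congr _ _ (hνμ.ae_eq (Lp.coeFn_add _ _)))
  have hSsmul : ∀ (c : ℂ) (F : E), S (c • F) = c • S F := fun c F => by
    simp only [S]
    rw [← map_smul, ← MemLp.toLp_const_smul]
    exact congrArg (szegoProjection (2 * α)) (MemLp.toLp_congr _ _ (hνμ.ae_eq (Lp.coeFn_smul _ _)))
  let L : E →ₗ[ℂ] Lp ℂ p μ :=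
    { toFun := fun F => (hS F).toLp _
      map_add' := fun F G => by
        rw [← MemLp.toLp_add]
        refine MemLp.toLp_congr _ _ ?_
        rw [hSadd]
        exact hμν.ae_le (Lp.coeFn_add _ _)
      map_smul' := fun c F => by
        rw [RingHom.id_apply, ← MemLp.toLp_const_smul]
        refine MemLp.toLp_congr _ _ ?_
        rw [hSsmul]
        exact hμν.ae_le (Lp.coeFn_smul _ _) }
  have hL : ∀ F : E, ‖L F‖ ≤ C.toReal * ‖E.subtype F‖ := fun F => by
    change ‖(hS F).toLp _‖ ≤ _
    rw [Lp.norm_toLp, Submodule.subtype_apply, Lp.norm_def, ← ENNReal.toReal_mul]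
    exact ENNReal.toReal_mono (ENNReal.mul_ne_top hC (Lp.eLpNorm_ne_top _)) (hbound _ (hE F))
  refine ⟨L.extendOfNorm E.subtype, fun f hf₂ hfp => ?_, fun T hT => ?_⟩
  · let F : E := ⟨hfp.toLp f, hf₂.ae_eq (hνμ.ae_eq hfp.coeFn_toLp).symm⟩
    have h1 : L.extendOfNorm E.subtype (hfp.toLp f) = (hS F).toLp _ :=
      LinearMap.extendOfNorm_eq hdense ⟨_, hL⟩ F
    have h2 : S F = szegoProjection (2 * α) (hf₂.toLp f) :=
      congrArg (szegoProjection (2 * α)) (MemLp.toLp_congr _ _ (hνμ.ae_eq hfp.coeFn_toLp))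
    rw [h1, ← h2]
    exact (volume_ac_circleMeasure _).ae_le (hS F).coeFn_toLp
  · refine ContinuousLinearMap.ext fun F => ?_
    -- Two continuous operators that agree with the projection on the dense intersection coincide.
    refine congrFun (hdense.equalizer T.continuous
      (L.extendOfNorm E.subtype).continuous (funext fun G => ?_)) F
    have h1 : L.extendOfNorm E.subtype (E.subtype G) = (hS G).toLp _ :=
      LinearMap.extendOfNorm_eq hdense ⟨_, hL⟩ G
    have h2 := hT (G : Lp ℂ p μ) (hE G) (Lp.memLp _)
    rw [Lp.toLp_coeFn] at h2
    rw [Function.comp_apply, Function.comp_apply, h1]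
    refine Lp.ext ?_
    filter_upwards [(withDensity_absolutelyContinuous _ _ : μ ≪ volume).ae_le h2,
      (hS G).coeFn_toLp] with θ h3 h4
    rw [h4]
    exact h3
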